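/- Let $(\mathcal S,\mathcal A,p,\nu)$ be a finite MDP with $S=|\mathcal S|$ states and $A=|\mathcal A|$ actions, with transition probabilities $p(x|s,a)$ and reward distributions $\nu(s,a)$ on $[0,1]$ with means $\mu(s,a)$. For a vector $q$ on $\mathcal S$ let $\sigma_q:\{1,\dots,S\}\to\mathcal S$ be a bijection with $q(\sigma_q(1))\ge\dots\ge q(\sigma_q(S))$, and write $\bar q:=q\circ\sigma_q$ for the ordered vector. For pairs $\ell,\ell'\in\mathcal S\times\mathcal A$ put $d(\ell,\ell'):=\|\bar p(\cdot|\ell)-\bar p(\cdot|\ell')\|_1$. The pairs $\ell,\ell'$ are called equivalent if $d(\ell,\ell')=0$ and $\mu(\ell)=\mu(\ell')$; the partition of $\mathcal S\times\mathcal A$ into equivalence classes is denoted by $\mathcal C$. A learner interacts with the MDP: at each step it is in a state $s_\tau$, chooses an action $a_\tau$ on the basis of the past (possibly with randomization), receives a reward drawn from $\nu(s_\tau,a_\tau)$, and moves to $s_{\tau+1}\sim p(\cdot|s_\tau,a_\tau)$. Let $N_t(\ell)$ be the number of times that the pair $\ell$ was played in the first $t$ steps and $\widehat p_t(\cdot|\ell)$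 the empirical distribution of the corresponding next states. Let $\delta\in(0,1]$ and $$\mathbb W_n(\eta)=\sqrt{\tfrac{2}{n}\left(1+\tfrac1n\right)\log\left(\sqrt{n+1}\,\tfrac{2^S-2}{\eta}\right)}\quad(\mathbb W_n:=0\text{ if }S=1),\qquad f(n)=4\,\mathbb W_n\left(\tfrac{\delta}{SA}\right)\quad(n>0),$$ and $f^{-1}(\Delta):=\inf\{n>0: f(n)\le\Delta\}$, which is the inverse function of $f$ if $S\ge2$. For $u\subseteq\mathcal S\times\mathcal A$ put $n(u)=\sum_{\ell\in u}N_t(\ell)$, $\widehat p(\cdot|u)=\frac1{n(u)}\sum_{\ell\in u}N_t(\ell)\,\overline{\widehat p_t}(\cdot|\ell)$, $\epsilon_u=\frac1{n(u)}\sum_{\ell\in u}N_t(\ell)\,\mathbb W_{N_t(\ell)}(\tfrac{\delta}{SA})$, and $\widehat d(u,v)=\|\widehat p(\cdot|u)-\widehat p(\cdot|v)\|_1-\epsilon_u-\epsilon_v$. Algorithm ApproxEquivalence with parameter $\alpha>1$, at time $t$. In a partition $\mathcal P$ of $\mathcal S\times\mathcal A$, a PAC neighbor of $c\in\mathcal P$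 is a $c'\in\mathcal P\setminus\{c\}$ such that $\widehat d(c,c')\le0$, $\widehat d(\{j\},\{j'\})\le0$ for all $j\in c,\ j'\in c'$, and $\widehat d(\{j\},c\cup c')\le0$ for all $j\in c\cup c'$; a PAC nearest neighbor of $c$ is a PAC neighbor $c'$ that minimizes $\widehat d(c,c')$. Start with the partition into singletons, each cluster being stored at its own index. In each round, with $\mathcal P$ the partition at the start of the round, go through the indices in non-increasing order of the numbers of observations that their clusters have at the start of the round. At an index $i$: if the cluster now stored there has no observations (for instance because it was merged into another one, which leaves $\emptyset$ at its index), end the round. Otherwise, if the cluster that was stored at $i$ at the start of the round has a PAC nearest neighbor in $\mathcal P$, take one, let $j$ be its index and let $u$, $v$ be the clusters now stored at $i$, $j$; if $n(v)\ne0$ and $\frac1\alpha\le\frac{n(u)/|u|}{n(v)/|v|}\le\alpha$, store $u\cup v$ at $i$ and $\emptyset$ at $j$. Repeat rounds until one of them changes nothing, and output the resulting partition. Ties are broken arbitrarily. Proposition. Assume that, for some $\Delta>0$, $d(\ell,\ell')\ge\Delta$ whenever $\ell,\ell'$ lie in different classes of $\mathcal C$. Then, with probability at least $1-\delta$, the following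 holds simultaneously for all times $t$ with $\min_{s,a}N_t(s,a)>f^{-1}(\Delta)$: for all sufficiently large $\alpha$, namely for all $\alpha>1$ with $\alpha\ge t/\max\{1,f^{-1}(\Delta)\}$, ApproxEquivalence run at time $t$ outputs exactly $\mathcal C$, however ties are broken. -/

import Mathlib

open MeasureTheory ProbabilityTheory

noncomputable section

/-- A finite MDP `(S, A, p, ν)`: `p s a x` is the probability of moving from `s` to `x` under the
action `a`, and `ν s a` is the reward distribution, a probability measure on `[0, 1]`. -/
structure MDP (S A : Type*) [Fintype S] where
  p : S → A → S → ℝ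
  p_mem : ∀ s a, p s a ∈ stdSimplex ℝ S
  ν : S → A → Measure ℝ
  ν_prob : ∀ s a, IsProbabilityMeasure (ν s a)
  ν_supp : ∀ s a, ν s a (Set.Icc 0 1)ᶜ = 0

/-- A profile mapping of `q`: an enumeration `σ` of the states along which `q` is
non-increasing. -/
def IsProfile {S : Type*} [Fintype S] (q : S → ℝ) (σ : Fin (Fintype.card S) ≃ S) : Prop :=
  Antitone (q ∘ σ)

/-- A profile mapping of `q` (ties are broken in a fixed way; by `IsProfile.comp_eq` below the
ordered vector `q ∘ σ` is the same for all profile mappings `σ` of `q`). -/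
def profile {S : Type*} [Fintype S] (q : S → ℝ) : Fin (Fintype.card S) ≃ S :=
  (Tuple.sort (fun k => -q ((Fintype.equivFin S).symm k))).trans (Fintype.equivFin S).symm

theorem isProfile_profile {S : Type*} [Fintype S] (q : S → ℝ) : IsProfile q (profile q) := by
  intro i j hij
  have h := Tuple.monotone_sort (fun k => -q ((Fintype.equivFin S).symm k)) hij
  simpa [profile] using h

theorem IsProfile.comp_eq {S : Type*} [Fintype S] {q : S → ℝ} {σ τ : Fin (Fintype.card S) ≃ S}
    (hσ : IsProfile q σ) (hτ : IsProfile q τ) : q ∘ σ = q ∘ τ := by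
  have h1 : Monotone ((fun k => -q (σ k)) ∘ (Equiv.refl _)) := fun i j hij => neg_le_neg (hσ hij)
  have h2 : Monotone ((fun k => -q (σ k)) ∘ (τ.trans σ.symm)) := by
    intro i j hij
    simpa using hτ hij
  have h := Tuple.unique_monotone h1 h2
  funext k
  simpa using congrFun h k

/-- The ordered vector `q ∘ σ_q`, indexed by ranks. -/
def ordered {S : Type*} [Fintype S] (q : S → ℝ) : Fin (Fintype.card S) → ℝ :=
  q ∘ profile q

/-- The `L¹` distance of two vectors. -/
def l1dist {ι : Type*} [Fintype ι] (x y : ι → ℝ) : ℝ := ∑ k, |x k - y k|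

theorem l1dist_le_zero_iff {ι : Type*} [Fintype ι] (x y : ι → ℝ) :
    l1dist x y ≤ 0 ↔ x = y := by
  constructor
  · intro h
    have h0 : ∑ k, |x k - y k| = 0 := le_antisymm h (Finset.sum_nonneg fun _ _ => abs_nonneg _)
    funext k
    have := (Finset.sum_eq_zero_iff_of_nonneg (fun k _ => abs_nonneg (x k - y k))).1 h0 k
      (Finset.mem_univ k)
    linarith [abs_eq_zero.1 this]
  · rintro rfl
    simp [l1dist]

namespace MDP

variable {S A : Type*} [Fintype S] [Fintype A]

/-- The mean reward of a pair. -/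
def mean (M : MDP S A) (ℓ : S × A) : ℝ := ∫ x, x ∂(M.ν ℓ.1 ℓ.2)

/-- `d({ℓ}, {ℓ'})`, the `L¹` distance of the ordered transition distributions of two pairs. -/
def dist (M : MDP S A) (ℓ ℓ' : S × A) : ℝ :=
  l1dist (ordered (M.p ℓ.1 ℓ.2)) (ordered (M.p ℓ'.1 ℓ'.2))

/-- `(εp, εμ)`-similarity of two state-action pairs. -/
def Similar (M : MDP S A) (εp εμ : ℝ) (ℓ ℓ' : S × A) : Prop :=
  M.dist ℓ ℓ' ≤ εp ∧ |M.mean ℓ - M.mean ℓ'| ≤ εμ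

/-- `(0, 0)`-similarity is an equivalence relation. -/
def similarSetoid (M : MDP S A) : Setoid (S × A) where
  r := M.Similar 0 0
  iseqv := by
    have key : ∀ ℓ ℓ', M.Similar 0 0 ℓ ℓ' ↔
        ordered (M.p ℓ.1 ℓ.2) = ordered (M.p ℓ'.1 ℓ'.2) ∧ M.mean ℓ = M.mean ℓ' := by
      intro ℓ ℓ'
      simp [Similar, dist, l1dist_le_zero_iff, sub_eq_zero]
    refine ⟨fun ℓ => (key _ _).2 ⟨rfl, rfl⟩, fun {x y} h => ?_, fun {x y z} h h' => ?_⟩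
    · have := (key _ _).1 h
      exact (key _ _).2 ⟨this.1.symm, this.2.symm⟩
    · have h1 := (key _ _).1 h
      have h2 := (key _ _).1 h'
      exact (key _ _).2 ⟨h1.1.trans h2.1, h1.2.trans h2.2⟩

open Classical in
/-- The equivalence structure `𝒞`: the partition of `S × A` into classes of
`(0, 0)`-similarity. -/
def classes (M : MDP S A) : Finset (Finset (S × A)) :=
  (Finpartition.ofSetoid M.similarSetoid).parts

/-- Separability at level `Δ`: pairs in different classes are at distance at least `Δ`. -/
def Separated (M : MDP S A) (Δ : ℝ) : Prop :=
  ∀ c ∈ M.classes, ∀ c' ∈ M.classes, c ≠ c' → ∀ ℓ ∈ c, ∀ ℓ' ∈ c', Δ ≤ M.dist ℓ ℓ'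

/-- The interaction of a learner with the MDP. At step `t` (steps are numbered from `0`) the
learner is in state `s t`, plays `a t`, and receives the reward `r t`. The σ-algebra `ℱ t` is the
information available when `a t` has been chosen (past states, actions and rewards, the current
state and action, and possibly the learner's own randomization). Given it, the reward is drawn from
`ν (s t) (a t)` and, independently, the next state from `p (s t) (a t)`. -/
structure IsInteraction {Ω : Type*} [mΩ : MeasurableSpace Ω] (M : MDP S A) (P : Measure Ω)
    (ℱ : Filtration ℕ mΩ) (s : ℕ → Ω → S) (a : ℕ → Ω → A) (r : ℕ → Ω → ℝ) : Prop where
  state_meas : ∀ t x, MeasurableSet[ℱ t] {ω | s t ω = x}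
  action_meas : ∀ t b, MeasurableSet[ℱ t] {ω | a t ω = b}
  reward_meas : ∀ t, Measurable[ℱ (t + 1)] (r t)
  law : ∀ (t : ℕ) (B : Set ℝ), MeasurableSet B → ∀ x : S,
    P[{ω | r t ω ∈ B ∧ s (t + 1) ω = x}.indicator (fun _ => (1 : ℝ)) | ℱ t] =ᵐ[P]
      fun ω => (M.ν (s t ω) (a t ω)).real B * M.p (s t ω) (a t ω) x

end MDP

section Empirical

variable {S A Ω : Type*} [DecidableEq S] [DecidableEq A]

/-- `N_t(ℓ)`: how often the pair `ℓ` was played during the first `t` steps. -/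
def visits (s : ℕ → Ω → S) (a : ℕ → Ω → A) (t : ℕ) (ω : Ω) (ℓ : S × A) : ℕ :=
  ((Finset.range t).filter fun τ => (s τ ω, a τ ω) = ℓ).card

/-- The empirical transition distribution of `ℓ` after the first `t` steps. -/
def empirical (s : ℕ → Ω → S) (a : ℕ → Ω → A) (t : ℕ) (ω : Ω) (ℓ : S × A) (x : S) : ℝ :=
  (((Finset.range t).filter fun τ => (s τ ω, a τ ω) = ℓ ∧ s (τ + 1) ω = x).card : ℝ) /
    (visits s a t ω ℓ : ℝ)

end Empirical

/-- The confidence width `𝕎_n(δ)` over an alphabet with `S` letters, for real `n > 0`. -/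
def confWidth (S : ℕ) (n δ : ℝ) : ℝ :=
  Real.sqrt (2 * (1 + 1 / n) * Real.log (Real.sqrt (n + 1) * (((2 : ℝ) ^ S - 2) / δ)) / n)

/-- `f(n) = 4 𝕎_n(δ / (S A))`. -/
def sepFun (S A : ℕ) (δ n : ℝ) : ℝ := 4 * confWidth S n (δ / ((S : ℝ) * (A : ℝ)))

/-- `f⁻¹(Δ)`. For `S ≥ 2` and `0 < δ ≤ 1` the function `f` is continuous and strictly decreasing
from `(0, ∞)` onto `(0, ∞)`, so that this is the solution `n` of `f(n) = Δ`. -/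
def sepFunInv (S A : ℕ) (δ Δ : ℝ) : ℝ := sInf {n : ℝ | 0 < n ∧ sepFun S A δ n ≤ Δ}

/-- What the clustering algorithm gets: the aggregation parameter `α`, the confidence parameter
`δ`, the numbers of observations and the empirical transition distributions of all pairs. -/
structure ClusterInput (S A : Type*) where
  α : ℝ
  δ : ℝ
  N : S × A → ℕ
  phat : S × A → S → ℝ

namespace ClusterInput

variable {S A : Type*} [Fintype S] [Fintype A] [DecidableEq S] [DecidableEq A]

/-- `n(u)`, the number of observations of pairs in `u`. -/
def count (D : ClusterInput S A) (u : Finset (S × A)) : ℕ := ∑ ℓ ∈ u, D.N ℓ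

/-- The aggregated empirical distribution of `u`, each member being ordered by its own empirical
profile. -/
def agg (D : ClusterInput S A) (u : Finset (S × A)) (k : Fin (Fintype.card S)) : ℝ :=
  1 / (D.count u : ℝ) * ∑ ℓ ∈ u, (D.N ℓ : ℝ) * ordered (D.phat ℓ) k

/-- The confidence width `ε_u`. -/
def eps (D : ClusterInput S A) (u : Finset (S × A)) : ℝ :=
  1 / (D.count u : ℝ) * ∑ ℓ ∈ u, (D.N ℓ : ℝ) *
    confWidth (Fintype.card S) (D.N ℓ) (D.δ / ((Fintype.card S : ℝ) * (Fintype.card A : ℝ)))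

/-- The lower-confidence distance function. -/
def dhat (D : ClusterInput S A) (u v : Finset (S × A)) : ℝ :=
  l1dist (D.agg u) (D.agg v) - D.eps u - D.eps v

/-- `c'` is a PAC neighbor of `c` in the partition `𝒞`. -/
structure IsPACNeighbor (D : ClusterInput S A) (𝒞 : Finset (Finset (S × A)))
    (c c' : Finset (S × A)) : Prop where
  mem : c' ∈ 𝒞
  ne : c' ≠ c
  sets : D.dhat c c' ≤ 0
  pairs : ∀ j ∈ c, ∀ j' ∈ c', D.dhat {j} {j'} ≤ 0
  union : ∀ j ∈ c ∪ c', D.dhat {j} (c ∪ c') ≤ 0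

/-- `c'` is a PAC nearest neighbor of `c` in the partition `𝒞`. -/
def IsNear (D : ClusterInput S A) (𝒞 : Finset (Finset (S × A))) (c c' : Finset (S × A)) : Prop :=
  D.IsPACNeighbor 𝒞 c c' ∧ ∀ u, D.IsPACNeighbor 𝒞 c u → D.dhat c c' ≤ D.dhat c u

/-- The partition stored in a table of clusters: `K i` is the cluster stored at the index `i`, and
`K i = ∅` once that cluster has been merged into another one. -/
def parts (K : S × A → Finset (S × A)) : Finset (Finset (S × A)) :=
  (Finset.univ.image K).erase ∅

/-- The cluster at `j` is merged into the one at `i`. -/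
def merge (K : S × A → Finset (S × A)) (i j : S × A) : S × A → Finset (S × A) :=
  Function.update (Function.update K i (K i ∪ K j)) j ∅

/-- The test `1/α ≤ (n(i)/L(i)) / (n(j)/L(j)) ≤ α`. It fails when the denominator vanishes, as it
does if the cluster at `j` has already been merged into another one. -/
def RatioTest (D : ClusterInput S A) (K : S × A → Finset (S × A)) (i j : S × A) : Prop :=
  D.count (K j) ≠ 0 ∧
  1 / D.α ≤ ((D.count (K i) : ℝ) / ((K i).card : ℝ)) / ((D.count (K j) : ℝ) / ((K j).card : ℝ)) ∧
  ((D.count (K i) : ℝ) / ((K i).card : ℝ)) / ((D.count (K j) : ℝ) / ((K j).card : ℝ)) ≤ D.α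

/-- The inner loop. `K₀` is the table at the start of the round, which determines the nearest
neighbors used in the round; `D.Loop K₀ l K K'` says that processing the list `l` of indices can
turn the current table `K` into `K'`. -/
inductive Loop (D : ClusterInput S A) (K₀ : S × A → Finset (S × A)) :
    List (S × A) → (S × A → Finset (S × A)) → (S × A → Finset (S × A)) → Prop
  | done (K : S × A → Finset (S × A)) : Loop D K₀ [] K K
  | brk (i : S × A) (l : List (S × A)) (K : S × A → Finset (S × A))
      (h0 : D.count (K i) = 0) : Loop D K₀ (i :: l) K K
  | noNear (i : S × A) (l : List (S × A)) (K K' : S × A → Finset (S × A))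
      (h0 : D.count (K i) ≠ 0)
      (hnear : ∀ c', ¬ D.IsNear (parts K₀) (K₀ i) c')
      (hrest : Loop D K₀ l K K') : Loop D K₀ (i :: l) K K'
  | reject (i j : S × A) (l : List (S × A)) (K K' : S × A → Finset (S × A))
      (h0 : D.count (K i) ≠ 0)
      (hnear : D.IsNear (parts K₀) (K₀ i) (K₀ j))
      (htest : ¬ D.RatioTest K i j)
      (hrest : Loop D K₀ l K K') : Loop D K₀ (i :: l) K K'
  | accept (i j : S × A) (l : List (S × A)) (K K' : S × A → Finset (S × A))
      (h0 : D.count (K i) ≠ 0)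
      (hnear : D.IsNear (parts K₀) (K₀ i) (K₀ j))
      (htest : D.RatioTest K i j)
      (hrest : Loop D K₀ l (merge K i j) K') : Loop D K₀ (i :: l) K K'

/-- `l` lists all indices in a non-increasing order of the numbers of observations of their
clusters. -/
def IsArgsort (D : ClusterInput S A) (K : S × A → Finset (S × A)) (l : List (S × A)) : Prop :=
  l.Nodup ∧ (∀ i, i ∈ l) ∧ l.Pairwise (fun i j => D.count (K j) ≤ D.count (K i))

/-- One round of the algorithm. -/
def Round (D : ClusterInput S A) (K K' : S × A → Finset (S × A)) : Prop :=
  ∃ l, D.IsArgsort K l ∧ D.Loop K l K K'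

/-- The outer loop: rounds are repeated until one of them changes nothing. -/
inductive Run (D : ClusterInput S A) :
    (S × A → Finset (S × A)) → (S × A → Finset (S × A)) → Prop
  | halt (K : S × A → Finset (S × A)) (hround : D.Round K K) : Run D K K
  | next (K K' K'' : S × A → Finset (S × A)) (hround : D.Round K K') (hne : K' ≠ K)
      (hrest : Run D K' K'') : Run D K K''

/-- `𝒟` is an output of the algorithm, started from the singletons (for some way of breaking ties
in the orderings and among nearest neighbors). -/
def Outputs (D : ClusterInput S A) (𝒟 : Finset (Finset (S × A))) : Prop :=
  ∃ K, D.Run (fun i => {i}) K ∧ parts K = 𝒟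

end ClusterInput

end

open MeasureTheory ProbabilityTheory

set_option linter.unusedSectionVars false

noncomputable section

/-! The proof combines a concentration event of probability at least `1 - δ`, valid for all times at
once, with a deterministic analysis of the algorithm on that event.

Concentration (`MDP.IsInteraction.measure_exists_confWidth_lt_le`). The L¹ deviation of an empirical
distribution is twice its largest excess over a set `B` of next states, and a positive deviation
forces `B` to be proper and non-empty. For a fixed pair and a fixed `B`, let `n` count the visits
and let `m` be the centred number of transitions into `B`. By Hoeffding's lemma `exp (x m - n x² /
8)` is a supermartingale for every `x`. Mixing over a Gaussian `x` removes the free parameter, and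
Ville's inequality controls the mixture uniformly in time. Inverting the mixture at the level
dictated by a union bound over the `S A` pairs and the `2 ^ S - 2` sets gives exactly the width `𝕎`.

Separation (`ClusterInput.resolves_of_l1dist_le`). Ordering is an L¹ contraction, so the ordered
empirical vectors are within the same widths of the true ones. Averaging and the triangle inequality
give `dhat ≤ 0` inside a class. Visit counts above `f⁻¹(Δ)` give `4 𝕎 < Δ`, hence `dhat > 0` between
pairs of different classes. A large `α` makes the ratio test always succeed.

Clustering (`ClusterInput.outputs_iff`). Merges then stay inside classes, and as long as a class is
spread over two clusters, these are PAC neighbors and the round merges something. Each change lowers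
the number of non-empty clusters, so the rounds stop, and they can only stop at the classes. -/

/-! ### Ordered vectors, L¹ distance and similarity classes -/

theorem sum_ordered {S : Type*} [Fintype S] (x : S → ℝ) : ∑ k, ordered x k = ∑ i, x i :=
  Equiv.sum_comp (profile x) x

/-- Pigeonhole: if it failed at rank `k`, the states of rank at most `k` for `x` would all have rank
less than `k` for `y`, and there is one too many of them. -/
theorem ordered_mono {S : Type*} [Fintype S] {x y : S → ℝ} (h : ∀ i, x i ≤ y i)
    (k : Fin (Fintype.card S)) : ordered x k ≤ ordered y k := by
  by_contra! hlt
  have hmaps : ∀ j ∈ Finset.Iic k, (profile y).symm (profile x j) ∈ Finset.Iio k := by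
    intro j hj
    rw [Finset.mem_Iio]
    by_contra! hk
    have h1 := isProfile_profile y hk
    have h2 := isProfile_profile x (Finset.mem_Iic.1 hj)
    have h3 := h (profile x j)
    simp only [Function.comp, ordered, Equiv.apply_symm_apply] at h1 h2 hlt
    linarith
  have := Finset.card_le_card_of_injOn _ hmaps
    (fun a _ b _ hab => (profile x).injective ((profile y).symm.injective hab))
  simp at this

/-- Ordering does not increase the `L¹` distance. -/
theorem l1dist_ordered_le {S : Type*} [Fintype S] (x y : S → ℝ) :
    l1dist (ordered x) (ordered y) ≤ l1dist x y := by
  have hx := ordered_mono (x := x) (y := fun i => max (x i) (y i)) fun i => le_max_left _ _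
  have hy := ordered_mono (x := y) (y := fun i => max (x i) (y i)) fun i => le_max_right _ _
  -- The pointwise maximum serves as pivot: `|a - b| ≤ (c - a) + (c - b)` for `c ≥ a, b`, with
  -- equality at `c = max a b`, and ordering preserves sums.
  set z : S → ℝ := fun i => max (x i) (y i) with hz
  calc l1dist (ordered x) (ordered y)
      ≤ ∑ k, ((ordered z k - ordered x k) + (ordered z k - ordered y k)) := by
        refine Finset.sum_le_sum fun k _ => abs_le.2 ⟨?_, ?_⟩ <;> linarith [hx k, hy k]
    _ = ∑ i, ((z i - x i) + (z i - y i)) := by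
        simp only [Finset.sum_add_distrib, Finset.sum_sub_distrib, sum_ordered]
    _ = l1dist x y := by
        refine Finset.sum_congr rfl fun i _ => ?_
        rcases le_total (x i) (y i) with h | h
        · rw [abs_of_nonpos (by linarith)]; simp [hz, h]
        · rw [abs_of_nonneg (by linarith)]; simp [hz, h]

theorem l1dist_comm {ι : Type*} [Fintype ι] (x y : ι → ℝ) : l1dist x y = l1dist y x :=
  Finset.sum_congr rfl fun _ _ => abs_sub_comm _ _

theorem l1dist_triangle {ι : Type*} [Fintype ι] (x y z : ι → ℝ) :
    l1dist x z ≤ l1dist x y + l1dist y z := by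
  rw [l1dist, l1dist, l1dist, ← Finset.sum_add_distrib]
  exact Finset.sum_le_sum fun k _ => abs_sub_le _ _ _

theorem MDP.mem_classes {S A : Type*} [Fintype S] [Fintype A] (M : MDP S A)
    (u : Finset (S × A)) : u ∈ M.classes ↔ ∃ i, ∀ ℓ, ℓ ∈ u ↔ M.similarSetoid i ℓ := by
  classical
  have hpart : ∀ i ℓ, ℓ ∈ (Finpartition.ofSetoid M.similarSetoid).part i ↔
      M.similarSetoid i ℓ := fun i ℓ => Finpartition.mem_part_ofSetoid_iff_rel
  have key : u ∈ (Finpartition.ofSetoid M.similarSetoid).parts ↔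
      ∃ i, ∀ ℓ, ℓ ∈ u ↔ M.similarSetoid i ℓ := by
    constructor
    · intro hu
      obtain ⟨i, hi⟩ := Finpartition.nonempty_of_mem_parts _ hu
      refine ⟨i, fun ℓ => ?_⟩
      rw [← hpart, Finpartition.part_eq_of_mem _ hu hi]
    · rintro ⟨i, hi⟩
      have : u = (Finpartition.ofSetoid M.similarSetoid).part i := by
        ext ℓ
        rw [hi, hpart]
      rw [this]
      exact (Finpartition.part_mem _).2 (Finset.mem_univ i)
  unfold MDP.classes
  convert key

/-! ### The algorithm on data that resolve the classes -/

namespace ClusterInput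

variable {S A : Type*} [Fintype S] [Fintype A] [DecidableEq S] [DecidableEq A]

/-- The data `D` resolve the classes of `R`: the lower-confidence distances are non-positive exactly
within the classes, and the ratio test holds between any two clusters. -/
structure Resolves (D : ClusterInput S A) (R : Setoid (S × A)) : Prop where
  N_pos : ∀ ℓ, 0 < D.N ℓ
  dhat_nonpos : ∀ u v : Finset (S × A), u.Nonempty → v.Nonempty →
    (∀ i ∈ u ∪ v, ∀ j ∈ u ∪ v, R i j) → D.dhat u v ≤ 0
  rel_of_dhat : ∀ i j, D.dhat {i} {j} ≤ 0 → R i j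
  ratio : ∀ K : S × A → Finset (S × A), ∀ i j, (K i).Nonempty → (K j).Nonempty → D.RatioTest K i j

/-- A table of disjoint clusters, each contained in the class of its index. -/
structure IsTable (R : Setoid (S × A)) (K : S × A → Finset (S × A)) : Prop where
  self_mem : ∀ i, (K i).Nonempty → i ∈ K i
  rel : ∀ i, ∀ ℓ ∈ K i, R i ℓ
  cover : ∀ ℓ, ∃ i, ℓ ∈ K i
  disj : ∀ i j ℓ, ℓ ∈ K i → ℓ ∈ K j → i = j

variable {D : ClusterInput S A} {R : Setoid (S × A)} {K K₀ K' : S × A → Finset (S × A)}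

theorem mem_parts {u : Finset (S × A)} : u ∈ parts K ↔ u.Nonempty ∧ ∃ i, K i = u := by
  simp [parts, Finset.nonempty_iff_ne_empty]

theorem count_ne_zero_iff (hD : D.Resolves R) (u : Finset (S × A)) :
    D.count u ≠ 0 ↔ u.Nonempty := by
  rw [← not_iff_not, not_not, Finset.not_nonempty_iff_eq_empty, count, Finset.sum_eq_zero_iff,
    Finset.eq_empty_iff_forall_notMem]
  exact forall_congr' fun ℓ => ⟨fun h hℓ => (hD.N_pos ℓ).ne' (h hℓ), fun h hℓ => absurd hℓ h⟩

theorem merge_left {i j : S × A} (h : i ≠ j) : merge K i j i = K i ∪ K j := by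
  simp [merge, h]

theorem merge_right {i j : S × A} : merge K i j j = ∅ := by
  simp [merge]

theorem merge_of_ne {i j k : S × A} (hi : k ≠ i) (hj : k ≠ j) : merge K i j k = K k := by
  simp [merge, hi, hj]

theorem mem_merge {i j k ℓ : S × A} (h : i ≠ j) :
    ℓ ∈ merge K i j k ↔ (k = i ∧ (ℓ ∈ K i ∨ ℓ ∈ K j)) ∨ (k ≠ i ∧ k ≠ j ∧ ℓ ∈ K k) := by
  by_cases hi : k = i
  · subst hi
    simp [merge_left h]
  · by_cases hj : k = j
    · subst hj
      simp [merge_right, hi]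
    · simp [merge_of_ne hi hj, hi, hj]

theorem isTable_singletons (R : Setoid (S × A)) : IsTable R (fun i => {i}) where
  self_mem i _ := Finset.mem_singleton_self i
  rel i ℓ h := by rw [Finset.mem_singleton.1 h]
  cover ℓ := ⟨ℓ, Finset.mem_singleton_self ℓ⟩
  disj i j ℓ hi hj := (Finset.mem_singleton.1 hi).symm.trans (Finset.mem_singleton.1 hj)

/-- Non-emptiness of `K i` matters: otherwise `i` would receive a cluster that does not contain it.
-/
theorem IsTable.merge (hK : IsTable R K) {i j : S × A} (hij : i ≠ j) (hR : R i j)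
    (hi : (K i).Nonempty) : IsTable R (merge K i j) where
  self_mem k hk := by
    obtain ⟨ℓ, hℓ⟩ := hk
    rw [mem_merge hij] at hℓ ⊢
    rcases hℓ with ⟨rfl, -⟩ | ⟨h1, h2, h3⟩
    · exact Or.inl ⟨rfl, Or.inl (hK.self_mem _ hi)⟩
    · exact Or.inr ⟨h1, h2, hK.self_mem _ ⟨ℓ, h3⟩⟩
  rel k ℓ hℓ := by
    rw [mem_merge hij] at hℓ
    rcases hℓ with ⟨rfl, h | h⟩ | ⟨-, -, h⟩
    · exact hK.rel _ _ h
    · exact R.trans hR (hK.rel _ _ h)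
    · exact hK.rel _ _ h
  cover ℓ := by
    obtain ⟨k, hk⟩ := hK.cover ℓ
    by_cases h : k = i ∨ k = j
    · refine ⟨i, (mem_merge hij).2 (Or.inl ⟨rfl, ?_⟩)⟩
      rcases h with rfl | rfl
      exacts [Or.inl hk, Or.inr hk]
    · push Not at h
      exact ⟨k, (mem_merge hij).2 (Or.inr ⟨h.1, h.2, hk⟩)⟩
  disj k m ℓ hk hm := by
    rw [mem_merge hij] at hk hm
    have := hK.disj
    grind

theorem nonempty_of_merge {i j k : S × A} (hij : i ≠ j) (hi : (K i).Nonempty)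
    (hk : (merge K i j k).Nonempty) : (K k).Nonempty := by
  obtain ⟨ℓ, hℓ⟩ := hk
  rw [mem_merge hij] at hℓ
  rcases hℓ with ⟨rfl, -⟩ | ⟨-, -, h⟩
  exacts [hi, ⟨ℓ, h⟩]

/-- A non-empty cluster contains its own index, so the pairwise condition can be tested at the two
indices alone. -/
theorem IsPACNeighbor.rel (hD : D.Resolves R) (hK : IsTable R K) {𝒞 : Finset (Finset (S × A))}
    {i j : S × A} (hi : (K i).Nonempty) (hj : (K j).Nonempty)
    (h : D.IsPACNeighbor 𝒞 (K i) (K j)) : R i j :=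
  hD.rel_of_dhat i j (h.pairs i (hK.self_mem i hi) j (hK.self_mem j hj))

/-- Two different clusters within a class are PAC neighbors, so a nearest neighbor exists. -/
theorem exists_isNear (hD : D.Resolves R) (hK : IsTable R K) {i j : S × A} (hij : i ≠ j)
    (hR : R i j) (hi : (K i).Nonempty) (hj : (K j).Nonempty) :
    ∃ c, D.IsNear (parts K) (K i) c := by
  have hrel : ∀ k ∈ K i ∪ K j, R i k := by
    intro k hk
    rcases Finset.mem_union.1 hk with h | h
    · exact hK.rel _ _ h
    · exact R.trans hR (hK.rel _ _ h)
  have hrel' : ∀ k ∈ K i ∪ K j, ∀ m ∈ K i ∪ K j, R k m := fun k hk m hm =>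
    R.trans (R.symm (hrel k hk)) (hrel m hm)
  have hpac : D.IsPACNeighbor (parts K) (K i) (K j) := by
    refine ⟨mem_parts.2 ⟨hj, j, rfl⟩, fun h => ?_, hD.dhat_nonpos _ _ hi hj hrel',
      fun k hk m hm => hD.dhat_nonpos _ _ (Finset.singleton_nonempty _)
        (Finset.singleton_nonempty _) fun x hx y hy => ?_,
      fun k hk => hD.dhat_nonpos _ _ (Finset.singleton_nonempty _)
        (hi.mono Finset.subset_union_left) fun x hx y hy => ?_⟩
    · exact hij (hK.disj i j i (hK.self_mem i hi) (h ▸ hK.self_mem i hi))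
    · simp only [Finset.mem_union, Finset.mem_singleton] at hx hy
      refine hrel' x ?_ y ?_ <;> simp only [Finset.mem_union] <;> grind
    · rw [Finset.union_eq_right.2 (Finset.singleton_subset_iff.2 hk)] at hx hy
      exact hrel' x hx y hy
  classical
  obtain ⟨c, hc, hmin⟩ := Finset.exists_min_image
    ((parts K).filter fun c => D.IsPACNeighbor (parts K) (K i) c) (D.dhat (K i))
    ⟨K j, Finset.mem_filter.2 ⟨hpac.mem, hpac⟩⟩
  exact ⟨c, (Finset.mem_filter.1 hc).2, fun u hu =>
    hmin u (Finset.mem_filter.2 ⟨hu.mem, hu⟩)⟩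

theorem IsNear.ne {𝒞 : Finset (Finset (S × A))} {i j : S × A}
    (h : D.IsNear 𝒞 (K i) (K j)) : i ≠ j := by
  rintro rfl
  exact h.1.ne rfl

/-- Neighbors are computed in `K₀` but merged in the current `K`. This is harmless: clusters
non-empty now were non-empty at the start of the round, so their indices already witness the
relation. An emptied index is never refilled, hence any merge leaves a visible change, which serves
for termination. -/
theorem Loop.isTable (hD : D.Resolves R) (hK₀ : IsTable R K₀) {l : List (S × A)}
    (h : D.Loop K₀ l K K') (hK : IsTable R K) (hsub : ∀ i, (K i).Nonempty → (K₀ i).Nonempty) :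
    IsTable R K' ∧ (∀ i, (K' i).Nonempty → (K i).Nonempty) ∧
      (K' = K ∨ ∃ j, (K j).Nonempty ∧ K' j = ∅) := by
  induction h with
  | done K => exact ⟨hK, fun _ h => h, Or.inl rfl⟩
  | brk i l K h0 => exact ⟨hK, fun _ h => h, Or.inl rfl⟩
  | noNear i l K K' h0 hnear hrest ih => exact ih hK hsub
  | reject i j l K K' h0 hnear htest hrest ih => exact ih hK hsub
  | accept i j l K K' h0 hnear htest hrest ih =>
    have hi := (count_ne_zero_iff hD _).1 h0
    have hj := (count_ne_zero_iff hD _).1 htest.1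
    have hij := hnear.ne
    have hmono : ∀ k, (ClusterInput.merge K i j k).Nonempty → (K k).Nonempty :=
      fun k => nonempty_of_merge hij hi
    obtain ⟨h1, h2, -⟩ := ih
      (hK.merge hij (hnear.1.rel hD hK₀ (hsub i hi) (hsub j hj)) hi)
      fun k hk => hsub k (hmono k hk)
    refine ⟨h1, fun k hk => hmono k (h2 k hk), Or.inr ⟨j, hj, ?_⟩⟩
    by_contra hne
    simpa [merge_right] using h2 j (Finset.nonempty_iff_ne_empty.2 hne)

/-- A round in which some cluster has a nearest neighbor performs a merge. -/
theorem Loop.ne_of_isNear (hD : D.Resolves R) (hK₀ : IsTable R K₀) {l : List (S × A)}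
    (h : D.Loop K₀ l K₀ K') (hl : l.Pairwise fun i j => D.count (K₀ j) ≤ D.count (K₀ i))
    {i : S × A} (hil : i ∈ l) (hi : (K₀ i).Nonempty) {c : Finset (S × A)}
    (hc : D.IsNear (parts K₀) (K₀ i) c) : K' ≠ K₀ := by
  induction l with
  | nil => simp at hil
  | cons m l ih =>
    rw [List.pairwise_cons] at hl
    cases h with
    -- Until the first merge the table is still `K₀`, and the indices before `i` have at least as
    -- many observations as `i`, so the loop cannot break early.
    | brk _ _ _ h0 =>
      have hi' := (count_ne_zero_iff hD _).2 hi
      rcases List.mem_cons.1 hil with rfl | h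
      · exact absurd h0 hi'
      · have := hl.1 i h
        omega
    | noNear _ _ _ _ h0 hnear hrest =>
      rcases List.mem_cons.1 hil with rfl | h
      · exact absurd hc (hnear c)
      · exact ih hrest hl.2 h
    | reject _ j _ _ _ h0 hnear htest hrest =>
      exact absurd (hD.ratio _ _ _ ((count_ne_zero_iff hD _).1 h0)
        (mem_parts.1 hnear.1.mem).1) htest
    | accept _ j _ _ _ h0 hnear htest hrest =>
      have hm := (count_ne_zero_iff hD _).1 h0
      have hj := (mem_parts.1 hnear.1.mem).1
      have hij := hnear.ne
      obtain ⟨-, h2, -⟩ := hrest.isTable hD hK₀ (hK₀.merge hij (hnear.1.rel hD hK₀ hm hj) hm)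
        fun k => nonempty_of_merge hij hm
      intro heq
      have := h2 j (heq ▸ hj)
      simp [merge_right] at this

theorem exists_loop (D : ClusterInput S A) (K₀ : S × A → Finset (S × A)) (l : List (S × A))
    (K : S × A → Finset (S × A)) : ∃ K', D.Loop K₀ l K K' := by
  induction l generalizing K with
  | nil => exact ⟨K, .done K⟩
  | cons i l ih =>
    by_cases h0 : D.count (K i) = 0
    · exact ⟨K, .brk i l K h0⟩
    by_cases hnear : ∃ c, D.IsNear (parts K₀) (K₀ i) c
    · obtain ⟨c, hc⟩ := hnear
      obtain ⟨-, j, rfl⟩ := mem_parts.1 hc.1.mem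
      by_cases htest : D.RatioTest K i j
      · obtain ⟨K', h⟩ := ih (merge K i j)
        exact ⟨K', .accept i j l K K' h0 hc htest h⟩
      · obtain ⟨K', h⟩ := ih K
        exact ⟨K', .reject i j l K K' h0 hc htest h⟩
    · obtain ⟨K', h⟩ := ih K
      exact ⟨K', .noNear i l K K' h0 (not_exists.1 hnear) h⟩

theorem exists_isArgsort (D : ClusterInput S A) (K : S × A → Finset (S × A)) :
    ∃ l, D.IsArgsort K l := by
  classical
  let r : S × A → S × A → Prop := fun i j => D.count (K j) ≤ D.count (K i)
  have : Std.Total r := ⟨fun i j => le_total (D.count (K j)) (D.count (K i))⟩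
  have : IsTrans (S × A) r := ⟨fun i j k (h : _ ≤ _) (h' : _ ≤ _) => h'.trans h⟩
  have hp := List.perm_insertionSort r (Finset.univ : Finset (S × A)).toList
  exact ⟨_, hp.nodup_iff.2 (Finset.nodup_toList _),
    fun i => hp.mem_iff.2 (Finset.mem_toList.2 (Finset.mem_univ i)),
    List.pairwise_insertionSort r _⟩

theorem Round.isTable (hD : D.Resolves R) (hK : IsTable R K) (h : D.Round K K') :
    IsTable R K' ∧ (∀ i, (K' i).Nonempty → (K i).Nonempty) ∧
      (K' = K ∨ ∃ j, (K j).Nonempty ∧ K' j = ∅) := by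
  obtain ⟨l, -, hl⟩ := h
  exact hl.isTable hD hK hK fun _ h => h

/-- Termination: a round that changes the table strictly lowers the number of non-empty clusters. -/
theorem exists_run (hD : D.Resolves R) (hK : IsTable R K) : ∃ K', D.Run K K' := by
  classical
  induction hn : (Finset.univ.filter fun i => (K i).Nonempty).card using Nat.strong_induction_on
    generalizing K with
  | _ n ih =>
    obtain ⟨l, hl⟩ := exists_isArgsort D K
    obtain ⟨K', hK'⟩ := exists_loop D K l K
    have hround : D.Round K K' := ⟨l, hl, hK'⟩
    obtain ⟨h1, h2, h3⟩ := hround.isTable hD hK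
    by_cases heq : K' = K
    · exact ⟨K, .halt K (heq ▸ hround)⟩
    obtain ⟨j, hj, hj'⟩ := h3.resolve_left heq
    obtain ⟨K'', h⟩ := ih _ (by
      rw [← hn]
      refine Finset.card_lt_card (Finset.ssubset_iff_of_subset ?_ |>.2 ⟨j, ?_, ?_⟩)
      · intro i hi
        simpa using h2 i (by simpa using hi)
      · simpa using hj
      · simp [hj']) h1 rfl
    exact ⟨K'', .next K K' K'' hround heq h⟩

theorem Run.isTable (hD : D.Resolves R) (hK : IsTable R K) (h : D.Run K K') :
    IsTable R K' ∧ D.Round K' K' := by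
  induction h with
  | halt K hround => exact ⟨hK, hround⟩
  | next K K' K'' hround hne hrest ih => exact ih (hround.isTable hD hK).1

/-- In a table that a round does not change, the clusters are whole classes. -/
theorem Round.mem_parts_iff (hD : D.Resolves R) (hK : IsTable R K) (h : D.Round K K)
    (u : Finset (S × A)) : u ∈ parts K ↔ ∃ i, ∀ ℓ, ℓ ∈ u ↔ R i ℓ := by
  obtain ⟨l, ⟨-, hmem, hl⟩, hloop⟩ := h
  have hclass : ∀ i, (K i).Nonempty → ∀ ℓ, ℓ ∈ K i ↔ R i ℓ := by
    refine fun i hi ℓ => ⟨hK.rel i ℓ, fun hR => ?_⟩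
    obtain ⟨j, hj⟩ := hK.cover ℓ
    by_cases hij : i = j
    · rwa [hij]
    -- If `ℓ` sat in another cluster, two clusters would share a class, and the round would not have
    -- left `K` unchanged.
    obtain ⟨c, hc⟩ := exists_isNear hD hK hij (R.trans hR (R.symm (hK.rel j ℓ hj))) hi ⟨ℓ, hj⟩
    exact absurd rfl (hloop.ne_of_isNear hD hK hl (hmem i) hi hc)
  rw [mem_parts]
  constructor
  · rintro ⟨hu, i, rfl⟩
    exact ⟨i, hclass i hu⟩
  · rintro ⟨i, hi⟩
    refine ⟨⟨i, (hi i).2 (R.refl i)⟩, ?_⟩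
    obtain ⟨j, hj⟩ := hK.cover i
    refine ⟨j, Finset.ext fun ℓ => ?_⟩
    rw [hclass j ⟨i, hj⟩, hi]
    have hji := hK.rel j i hj
    exact ⟨fun h => R.trans (R.symm hji) h, fun h => R.trans hji h⟩

/-- Every finished run ends in `𝒞`; the converse also needs that some run finishes. -/
theorem outputs_iff (hD : D.Resolves R) {𝒞 : Finset (Finset (S × A))}
    (h𝒞 : ∀ u, u ∈ 𝒞 ↔ ∃ i, ∀ ℓ, ℓ ∈ u ↔ R i ℓ) (𝒟 : Finset (Finset (S × A))) :
    D.Outputs 𝒟 ↔ 𝒟 = 𝒞 := by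
  have key : ∀ K, D.Run (fun i => {i}) K → parts K = 𝒞 := by
    intro K hK
    obtain ⟨h1, h2⟩ := hK.isTable hD (isTable_singletons R)
    ext u
    rw [h𝒞, h2.mem_parts_iff hD h1]
  constructor
  · rintro ⟨K, hK, rfl⟩
    exact key K hK
  · rintro rfl
    obtain ⟨K, hK⟩ := exists_run hD (isTable_singletons R)
    exact ⟨K, hK, key K hK⟩

end ClusterInput

/-! ### Monotonicity and decay of the confidence width -/

theorem confWidth_nonneg (S : ℕ) (n η : ℝ) : 0 ≤ confWidth S n η := Real.sqrt_nonneg _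

/-- Bernoulli's inequality with exponent `n / m > 1`: `1 + n < (1 + m) ^ (n / m)`; take logarithms.
-/
theorem log_add_one_div_le {m n : ℝ} (hm : 0 < m) (hmn : m < n) :
    Real.log (n + 1) / n ≤ Real.log (m + 1) / m := by
  have hn := hm.trans hmn
  have h := one_add_mul_self_lt_rpow_one_add (s := m) (by linarith) hm.ne'
    ((one_lt_div hm).2 hmn)
  rw [div_mul_cancel₀ _ hm.ne'] at h
  have h2 := Real.log_lt_log (by linarith) h
  rw [Real.log_rpow (by linarith), add_comm 1 n, add_comm 1 m] at h2
  rw [div_le_div_iff₀ hn hm]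
  calc Real.log (n + 1) * m ≤ n / m * Real.log (m + 1) * m := by gcongr
    _ = Real.log (m + 1) * n := by field_simp

/-- The radicand is `(1 + 1/x) (log (x + 1) / x + 2 log c / x)`, a product of decreasing positive
factors once `c > 1`. -/
theorem confWidth_lt_confWidth {S : ℕ} {m n η : ℝ} (hc : 1 < ((2 : ℝ) ^ S - 2) / η) (hm : 0 < m)
    (hmn : m < n) : confWidth S n η < confWidth S m η := by
  have hn := hm.trans hmn
  set c := ((2 : ℝ) ^ S - 2) / η with hcdef
  have hlc : 0 < Real.log c := Real.log_pos hc
  have hlog : ∀ x : ℝ, 0 < x → 2 * (1 + 1 / x) * Real.log (Real.sqrt (x + 1) * c) / x =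
      (1 + 1 / x) * (Real.log (x + 1) / x + 2 * Real.log c / x) := by
    intro x hx
    rw [Real.log_mul (Real.sqrt_pos.2 (by linarith)).ne' (by linarith),
      Real.log_sqrt (by linarith)]
    field_simp
  unfold confWidth
  rw [← hcdef, hlog n hn, hlog m hm]
  have h1 : 1 / n < 1 / m := one_div_lt_one_div_of_lt hm hmn
  have h2 := log_add_one_div_le hm hmn
  have h3 : 2 * Real.log c / n < 2 * Real.log c / m := by gcongr
  have h4 : 0 < Real.log (n + 1) / n := div_pos (Real.log_pos (by linarith)) hn
  have h5 : 0 < 2 * Real.log c / n := by positivity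
  refine Real.sqrt_lt_sqrt (by positivity) ?_
  exact mul_lt_mul (by linarith) (by linarith) (by positivity) (by positivity)

theorem exists_confWidth_le (S : ℕ) {η ε : ℝ} (hc : 0 < ((2 : ℝ) ^ S - 2) / η) (hε : 0 < ε) :
    ∃ n : ℝ, 0 < n ∧ confWidth S n η ≤ ε := by
  set c := ((2 : ℝ) ^ S - 2) / η with hcdef
  -- At `n = K ^ 2` the crude bound `log y ≤ y` makes the radicand at most `8 c / K`, which this
  -- choice brings below `ε ^ 2`.
  set K : ℝ := max 1 (8 * c / ε ^ 2) with hK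
  have hK1 : 1 ≤ K := le_max_left _ _
  have hK2 : 8 * c / ε ^ 2 ≤ K := le_max_right _ _
  refine ⟨K ^ 2, by positivity, ?_⟩
  unfold confWidth
  rw [← hcdef]
  refine Real.sqrt_le_iff.2 ⟨hε.le, ?_⟩
  have hs : Real.sqrt (K ^ 2 + 1) ≤ 2 * K := Real.sqrt_le_iff.2 ⟨by positivity, by nlinarith⟩
  have hs0 : 0 < Real.sqrt (K ^ 2 + 1) := Real.sqrt_pos.2 (by positivity)
  have hl : Real.log (Real.sqrt (K ^ 2 + 1) * c) ≤ 2 * K * c :=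
    (Real.log_le_self (by positivity)).trans (by gcongr)
  have hi : 1 / K ^ 2 ≤ 1 := (div_le_one (by positivity)).2 (by nlinarith)
  have hi0 : 0 < 1 / K ^ 2 := by positivity
  calc 2 * (1 + 1 / K ^ 2) * Real.log (Real.sqrt (K ^ 2 + 1) * c) / K ^ 2
      ≤ 2 * (1 + 1 / K ^ 2) * (2 * K * c) / K ^ 2 := by gcongr
    _ ≤ 2 * (1 + 1) * (2 * K * c) / K ^ 2 := by gcongr
    _ = 8 * c / K := by field_simp; ring
    _ ≤ ε ^ 2 := by
      rw [div_le_iff₀ (by positivity)] at hK2 ⊢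
      linarith

/-- Here `2 ^ 1 - 2 = 0` and `Real.log 0 = 0`, so the formula agrees with the convention for a
single state. -/
theorem confWidth_one (n η : ℝ) : confWidth 1 n η = 0 := by
  simp [confWidth]

theorem sepFunInv_nonneg (S A : ℕ) (δ Δ : ℝ) : 0 ≤ sepFunInv S A δ Δ :=
  Real.sInf_nonneg fun _ h => h.1.le

theorem one_lt_mul_div_of_two_le {S A : ℕ} {δ : ℝ} (hS : 2 ≤ S) (hA : 0 < A) (hδ0 : 0 < δ)
    (hδ1 : δ ≤ 1) : 1 < ((2 : ℝ) ^ S - 2) / (δ / ((S : ℝ) * (A : ℝ))) := by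
  have hS' : (2 : ℝ) ≤ S := by exact_mod_cast hS
  have hA' : (1 : ℝ) ≤ A := by exact_mod_cast hA
  have h4 : (2 : ℝ) ^ 2 ≤ 2 ^ S := pow_le_pow_right₀ (by norm_num) hS
  rw [lt_div_iff₀ (by positivity), one_mul, div_lt_iff₀ (by positivity)]
  have : (1 : ℝ) < S * A := by nlinarith
  nlinarith

/-- No inverse function is needed: some `m < N` in the set defining the infimum has `f m ≤ Δ`, and
strict monotonicity carries this to `N`. A single state is separate, its width being `0`. -/
theorem sepFun_lt {S A : ℕ} (hS : 0 < S) (hA : 0 < A) {δ Δ N : ℝ} (hδ0 : 0 < δ) (hδ1 : δ ≤ 1)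
    (hΔ : 0 < Δ) (hN : sepFunInv S A δ Δ < N) : sepFun S A δ N < Δ := by
  rcases Nat.lt_or_ge 1 S with h2 | h1
  · have hc := one_lt_mul_div_of_two_le h2 hA hδ0 hδ1
    obtain ⟨n, hn0, hn⟩ := exists_confWidth_le S (one_pos.trans hc)
      (show 0 < Δ / 4 by positivity)
    obtain ⟨m, ⟨hm0, hm⟩, hmN⟩ := exists_lt_of_csInf_lt
      (s := {n : ℝ | 0 < n ∧ sepFun S A δ n ≤ Δ}) ⟨n, hn0, by unfold sepFun; linarith⟩ hN
    have := confWidth_lt_confWidth hc hm0 hmN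
    unfold sepFun at hm ⊢
    linarith
  · obtain rfl : S = 1 := by omega
    simpa [sepFun, confWidth_one] using hΔ

/-! ### From confidence widths to resolution of the classes -/

namespace ClusterInput

variable {S A : Type*} [Fintype S] [Fintype A] [DecidableEq S] [DecidableEq A]

theorem dhat_singleton (D : ClusterInput S A) (hN : ∀ ℓ, 0 < D.N ℓ) (i j : S × A) :
    D.dhat {i} {j} = l1dist (ordered (D.phat i)) (ordered (D.phat j)) -
      confWidth (Fintype.card S) (D.N i) (D.δ / ((Fintype.card S : ℝ) * (Fintype.card A : ℝ))) -
      confWidth (Fintype.card S) (D.N j) (D.δ / ((Fintype.card S : ℝ) * (Fintype.card A : ℝ))) := by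
  have hi : (D.N i : ℝ) ≠ 0 := by exact_mod_cast (hN i).ne'
  have hj : (D.N j : ℝ) ≠ 0 := by exact_mod_cast (hN j).ne'
  have hagg : ∀ i, (D.N i : ℝ) ≠ 0 → D.agg {i} = ordered (D.phat i) := by
    intro i hi
    funext k
    simp [agg, count, hi]
  simp [dhat, hagg i hi, hagg j hj, eps, count, hi, hj]

/-- Convexity of the norm: `D.agg u` and `D.eps u` average the ordered vectors and their widths with
the same weights. -/
theorem l1dist_agg_le (D : ClusterInput S A) (hN : ∀ ℓ, 0 < D.N ℓ) {u : Finset (S × A)}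
    (hu : u.Nonempty) (q : Fin (Fintype.card S) → ℝ)
    (hq : ∀ ℓ ∈ u, l1dist (ordered (D.phat ℓ)) q ≤
      confWidth (Fintype.card S) (D.N ℓ) (D.δ / ((Fintype.card S : ℝ) * (Fintype.card A : ℝ)))) :
    l1dist (D.agg u) q ≤ D.eps u := by
  have hn : (0 : ℝ) < D.count u := by
    exact_mod_cast Finset.sum_pos (fun ℓ _ => hN ℓ) hu
  have hcount : (D.count u : ℝ) = ∑ ℓ ∈ u, (D.N ℓ : ℝ) := by simp [count]
  have hk : ∀ k, |D.agg u k - q k| ≤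
      1 / (D.count u : ℝ) * ∑ ℓ ∈ u, (D.N ℓ : ℝ) * |ordered (D.phat ℓ) k - q k| := by
    intro k
    have : D.agg u k - q k =
        1 / (D.count u : ℝ) * ∑ ℓ ∈ u, (D.N ℓ : ℝ) * (ordered (D.phat ℓ) k - q k) := by
      simp only [mul_sub, Finset.sum_sub_distrib, ← Finset.sum_mul, ← hcount, agg]
      field_simp
    rw [this, abs_mul, abs_of_nonneg (by positivity : 0 ≤ 1 / (D.count u : ℝ))]
    gcongr
    refine (Finset.abs_sum_le_sum_abs _ _).trans_eq (Finset.sum_congr rfl fun ℓ _ => ?_)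
    rw [abs_mul, Nat.abs_cast]
  calc l1dist (D.agg u) q
      ≤ ∑ k, 1 / (D.count u : ℝ) * ∑ ℓ ∈ u, (D.N ℓ : ℝ) * |ordered (D.phat ℓ) k - q k| :=
        Finset.sum_le_sum fun k _ => hk k
    _ = 1 / (D.count u : ℝ) * ∑ ℓ ∈ u, (D.N ℓ : ℝ) * l1dist (ordered (D.phat ℓ)) q := by
        rw [← Finset.mul_sum, Finset.sum_comm]
        simp only [l1dist, Finset.mul_sum]
    _ ≤ D.eps u := by
        unfold eps
        gcongr with ℓ hℓ
        exact hq ℓ hℓ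

theorem resolves_of_l1dist_le (D : ClusterInput S A) (M : MDP S A) {Δ : ℝ} (hΔ : 0 < Δ)
    (hsep : M.Separated Δ) (hδ0 : 0 < D.δ) (hδ1 : D.δ ≤ 1)
    (hN : ∀ ℓ, sepFunInv (Fintype.card S) (Fintype.card A) D.δ Δ < D.N ℓ)
    (hα : (∑ ℓ, (D.N ℓ : ℝ)) / max 1 (sepFunInv (Fintype.card S) (Fintype.card A) D.δ Δ) ≤ D.α)
    (hphat : ∀ ℓ, l1dist (D.phat ℓ) (M.p ℓ.1 ℓ.2) ≤
      confWidth (Fintype.card S) (D.N ℓ) (D.δ / ((Fintype.card S : ℝ) * (Fintype.card A : ℝ)))) :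
    D.Resolves M.similarSetoid := by
  set F := sepFunInv (Fintype.card S) (Fintype.card A) D.δ Δ with hF
  have hN0 : ∀ ℓ, 0 < D.N ℓ := fun ℓ => by
    exact_mod_cast (sepFunInv_nonneg _ _ _ _).trans_lt (hN ℓ)
  have hord : ∀ ℓ, l1dist (ordered (D.phat ℓ)) (ordered (M.p ℓ.1 ℓ.2)) ≤
      confWidth (Fintype.card S) (D.N ℓ) (D.δ / ((Fintype.card S : ℝ) * (Fintype.card A : ℝ))) :=
    fun ℓ => (l1dist_ordered_le _ _).trans (hphat ℓ)
  have hmem : ∀ i : S × A, ∃ c ∈ M.classes, ∀ ℓ, ℓ ∈ c ↔ M.similarSetoid i ℓ := by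
    classical
    intro i
    refine ⟨Finset.univ.filter fun ℓ => M.similarSetoid i ℓ, (M.mem_classes _).2 ⟨i, ?_⟩, ?_⟩ <;>
      simp
  refine ⟨hN0, fun u v hu hv huv => ?_, fun i j hij => ?_, fun K i j hi hj => ?_⟩
  · obtain ⟨i, hi⟩ := hu
    have hcenter : ∀ ℓ ∈ u ∪ v, ordered (M.p ℓ.1 ℓ.2) = ordered (M.p i.1 i.2) := fun ℓ hℓ =>
      (l1dist_le_zero_iff _ _).1 (huv ℓ hℓ i (Finset.mem_union_left _ hi)).1
    have h1 := D.l1dist_agg_le hN0 ⟨i, hi⟩ (ordered (M.p i.1 i.2)) fun ℓ hℓ =>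
      hcenter ℓ (Finset.mem_union_left _ hℓ) ▸ hord ℓ
    have h2 := D.l1dist_agg_le hN0 hv (ordered (M.p i.1 i.2)) fun ℓ hℓ =>
      hcenter ℓ (Finset.mem_union_right _ hℓ) ▸ hord ℓ
    have h3 := l1dist_triangle (D.agg u) (ordered (M.p i.1 i.2)) (D.agg v)
    rw [l1dist_comm (ordered _) (D.agg v)] at h3
    unfold dhat
    linarith
  · by_contra hne
    obtain ⟨c, hc, hci⟩ := hmem i
    obtain ⟨c', hc', hcj⟩ := hmem j
    have hd := hsep c hc c' hc' (fun h => hne ((hci j).1 (h ▸ (hcj j).2 (M.similarSetoid.refl j))))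
      i ((hci i).2 (M.similarSetoid.refl i)) j ((hcj j).2 (M.similarSetoid.refl j))
    -- With `dhat ≤ 0` the true distance is at most `2 𝕎_i + 2 𝕎_j`, which is less than `Δ`; this is
    -- the origin of the factor `4` in `f`.
    rw [D.dhat_singleton hN0] at hij
    have hw : ∀ ℓ, 4 * confWidth (Fintype.card S) (D.N ℓ)
        (D.δ / ((Fintype.card S : ℝ) * (Fintype.card A : ℝ))) < Δ := fun ℓ =>
      sepFun_lt (Fintype.card_pos_iff.2 ⟨i.1⟩) (Fintype.card_pos_iff.2 ⟨i.2⟩) hδ0 hδ1 hΔ (hN ℓ)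
    have h1 := l1dist_triangle (ordered (M.p i.1 i.2)) (ordered (D.phat i)) (ordered (M.p j.1 j.2))
    have h2 := l1dist_triangle (ordered (D.phat i)) (ordered (D.phat j)) (ordered (M.p j.1 j.2))
    rw [l1dist_comm _ (ordered (D.phat i))] at h1
    unfold MDP.dist at hd
    linarith [hw i, hw j, hord i, hord j]
  -- Every average count per pair lies between `max 1 F` and the total number of observations, so
  -- any ratio of two of them is at most `α`.
  · have hM : 0 < max 1 F := lt_max_of_lt_left one_pos
    have hcount : ∀ u : Finset (S × A), (D.count u : ℝ) = ∑ ℓ ∈ u, (D.N ℓ : ℝ) := by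
      simp [count]
    have hcard : ∀ u : Finset (S × A), u.Nonempty → (1 : ℝ) ≤ u.card := fun u hu => by
      exact_mod_cast hu.card_pos
    have hlow : ∀ u : Finset (S × A), u.Nonempty →
        max 1 F ≤ (D.count u : ℝ) / (u.card : ℝ) := by
      intro u hu
      rw [le_div_iff₀ (by linarith [hcard u hu]), hcount, mul_comm, ← nsmul_eq_mul]
      refine Finset.card_nsmul_le_sum _ _ _ fun ℓ _ => max_le ?_ (hN ℓ).le
      exact_mod_cast hN0 ℓ
    have hupp : ∀ u : Finset (S × A), u.Nonempty →
        (D.count u : ℝ) / (u.card : ℝ) ≤ ∑ ℓ, (D.N ℓ : ℝ) := by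
      intro u hu
      refine (div_le_self (Nat.cast_nonneg _) (hcard u hu)).trans ?_
      rw [hcount]
      exact Finset.sum_le_sum_of_subset_of_nonneg (Finset.subset_univ _) fun _ _ _ =>
        Nat.cast_nonneg _
    have hratio : ∀ u v : Finset (S × A), u.Nonempty → v.Nonempty →
        ((D.count u : ℝ) / (u.card : ℝ)) / ((D.count v : ℝ) / (v.card : ℝ)) ≤ D.α := by
      intro u v hu hv
      refine le_trans ?_ hα
      have := hM.trans_le (hlow v hv)
      have := hM.trans_le (hlow u hu)
      gcongr
      exacts [hupp u hu, hlow v hv]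
    have hposi := hM.trans_le (hlow _ hi)
    have hposj := hM.trans_le (hlow _ hj)
    refine ⟨?_, ?_, hratio _ _ hi hj⟩
    · have : 0 < D.count (K j) := Finset.sum_pos (fun ℓ _ => hN0 ℓ) hj
      exact this.ne'
    · have := hratio _ _ hj hi
      have hpos : 0 < D.α := (div_pos hposj hposi).trans_le this
      rw [div_le_iff₀ hpos]
      rw [div_le_iff₀ hposi] at this
      rw [div_mul_eq_mul_div, le_div_iff₀ hposj, one_mul]
      linarith

end ClusterInput

/-! ### The Gaussian mixture of exponential supermartingales -/

/-- Hoeffding's lemma for a Bernoulli variable. -/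
theorem bernoulli_mgf_le {q : ℝ} (hq : q ∈ Set.Icc (0 : ℝ) 1) (x : ℝ) :
    q * Real.exp (x * (1 - q)) + (1 - q) * Real.exp (x * (0 - q)) ≤ Real.exp (x ^ 2 / 8) := by
  obtain ⟨hq0, hq1⟩ := hq
  let μ : Measure ℝ := ENNReal.ofReal q • Measure.dirac 1 + ENNReal.ofReal (1 - q) • Measure.dirac 0
  have hμ : IsProbabilityMeasure μ := ⟨by
    simp [μ, ← ENNReal.ofReal_add hq0 (sub_nonneg.2 hq1)]⟩
  have hint : ∀ g : ℝ → ℝ, ∫ y, g y ∂μ = q * g 1 + (1 - q) * g 0 := by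
    intro g
    rw [integral_add_measure, integral_smul_measure, integral_smul_measure, integral_dirac,
      integral_dirac, ENNReal.toReal_ofReal hq0, ENNReal.toReal_ofReal (sub_nonneg.2 hq1)]
    · rfl
    · exact (integrable_dirac (by simp)).smul_measure (by simp)
    · exact (integrable_dirac (by simp)).smul_measure (by simp)
  have h := (hasSubgaussianMGF_of_mem_Icc (μ := μ) (X := id) (a := 0) (b := 1)
    aemeasurable_id (by simp [μ, ae_iff])).mgf_le x
  rw [mgf, hint] at h
  have hm : ∫ y, id y ∂μ = q := by rw [hint]; simp
  rw [hm] at h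
  refine h.trans_eq ?_
  congr 1
  simp
  ring

theorem exp_quadratic_eq {b : ℝ} (hb : 0 < b) (m x : ℝ) :
    Real.exp (x * m - b * x ^ 2) =
      Real.exp (m ^ 2 / (4 * b)) * Real.exp (-b * (x - m / (2 * b)) ^ 2) := by
  rw [← Real.exp_add]
  congr 1
  field_simp
  ring

theorem integrable_exp_quadratic {b : ℝ} (hb : 0 < b) (m : ℝ) :
    Integrable fun x : ℝ => Real.exp (x * m - b * x ^ 2) := by
  simp_rw [exp_quadratic_eq hb]
  exact ((integrable_exp_neg_mul_sq hb).comp_sub_right _).const_mul _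

theorem integral_exp_quadratic {b : ℝ} (hb : 0 < b) (m : ℝ) :
    ∫ x : ℝ, Real.exp (x * m - b * x ^ 2) =
      Real.exp (m ^ 2 / (4 * b)) * Real.sqrt (Real.pi / b) := by
  simp_rw [exp_quadratic_eq hb]
  rw [integral_const_mul, integral_sub_right_eq_self (fun x : ℝ => Real.exp (-b * x ^ 2)),
    integral_gaussian]

/-- The Gaussian mixture `∫ exp (x m - n x² / 8) dN(0, 4)(x)`, in closed form. -/
def gaussMix (n m : ℝ) : ℝ := Real.exp (2 * m ^ 2 / (n + 1)) / Real.sqrt (n + 1)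

theorem gaussMix_nonneg (n m : ℝ) : 0 ≤ gaussMix n m := by
  unfold gaussMix
  positivity

/-- The density of `N(0, 4)` is proportional to `exp (-x² / 8)`, so the prior acts like one extra
observation and turns `n` into `n + 1`. -/
theorem gaussMix_eq_integral {n : ℝ} (hn : 0 ≤ n) (m : ℝ) :
    gaussMix n m = (Real.sqrt (8 * Real.pi))⁻¹ *
      ∫ x : ℝ, Real.exp (x * m - (n + 1) / 8 * x ^ 2) := by
  rw [integral_exp_quadratic (by positivity), gaussMix]
  have h1 : Real.pi / ((n + 1) / 8) = 8 * Real.pi / (n + 1) := by field_simp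
  have h2 : m ^ 2 / (4 * ((n + 1) / 8)) = 2 * m ^ 2 / (n + 1) := by field_simp; ring
  have h3 : Real.sqrt (8 * Real.pi) ≠ 0 := (Real.sqrt_pos.2 (by positivity)).ne'
  rw [h1, h2, Real.sqrt_div (by positivity)]
  field_simp

/-- The supermartingale step: for each fixed `x` it is Hoeffding's lemma, and integrating over `x`
preserves it. -/
theorem gaussMix_step {n q : ℝ} (hn : 0 ≤ n) (hq : q ∈ Set.Icc (0 : ℝ) 1) (m : ℝ) :
    q * gaussMix (n + 1) (m + (1 - q)) + (1 - q) * gaussMix (n + 1) (m + (0 - q)) ≤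
      gaussMix n m := by
  have hb : 0 < (n + 1 + 1) / 8 := by positivity
  rw [gaussMix_eq_integral (by positivity), gaussMix_eq_integral (by positivity),
    gaussMix_eq_integral hn, mul_left_comm, mul_left_comm (1 - q), ← mul_add]
  gcongr
  rw [← integral_const_mul, ← integral_const_mul,
    ← integral_add ((integrable_exp_quadratic hb _).const_mul _)
      ((integrable_exp_quadratic hb _).const_mul _)]
  refine integral_mono (((integrable_exp_quadratic hb _).const_mul _).add
      ((integrable_exp_quadratic hb _).const_mul _))
    (integrable_exp_quadratic (by positivity) _) fun x => ?_
  have h := bernoulli_mgf_le hq x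
  have e : ∀ y, Real.exp (x * (m + y) - (n + 1 + 1) / 8 * x ^ 2) =
      Real.exp (x * m - (n + 1) / 8 * x ^ 2 - x ^ 2 / 8) * Real.exp (x * y) := by
    intro y
    rw [← Real.exp_add]
    congr 1
    ring
  have e' : Real.exp (x * m - (n + 1) / 8 * x ^ 2) =
      Real.exp (x * m - (n + 1) / 8 * x ^ 2 - x ^ 2 / 8) * Real.exp (x ^ 2 / 8) := by
    rw [← Real.exp_add]
    congr 1
    ring
  simp only [e, e']
  calc _ = Real.exp (x * m - (n + 1) / 8 * x ^ 2 - x ^ 2 / 8) *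
      (q * Real.exp (x * (1 - q)) + (1 - q) * Real.exp (x * (0 - q))) := by ring
    _ ≤ _ := by gcongr

theorem gaussMix_le {n m k : ℝ} (hn : 0 ≤ n) (hm : |m| ≤ k) :
    gaussMix n m ≤ Real.exp (2 * k ^ 2) := by
  have h1 : 1 ≤ Real.sqrt (n + 1) := Real.one_le_sqrt.2 (by linarith)
  have h2 : m ^ 2 ≤ k ^ 2 := sq_le_sq.2 (hm.trans (le_abs_self k))
  calc gaussMix n m ≤ Real.exp (2 * m ^ 2 / (n + 1)) := div_le_self (Real.exp_pos _).le h1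
    _ ≤ Real.exp (2 * k ^ 2) := by
      refine Real.exp_le_exp.2 ((div_le_self (by positivity) (by linarith)).trans (by linarith))

/-- The width is the inequality `c ≤ gaussMix n m` solved for `m`. The factor `2` anticipates that
an L¹ distance is twice an excess over a set. -/
theorem le_gaussMix_of_sqrt_lt {n m c : ℝ} (hn : 0 < n) (hc : 0 < c)
    (h : Real.sqrt (2 * (1 + 1 / n) * Real.log (Real.sqrt (n + 1) * c) / n) < 2 * (m / n)) :
    c ≤ gaussMix n m := by
  have hs : 0 < Real.sqrt (n + 1) := Real.sqrt_pos.2 (by linarith)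
  rw [Real.sqrt_lt' ((Real.sqrt_nonneg _).trans_lt h)] at h
  have h1 : 2 * (1 + 1 / n) * Real.log (Real.sqrt (n + 1) * c) / n =
      2 * (n + 1) / n ^ 2 * Real.log (Real.sqrt (n + 1) * c) := by field_simp
  have h2 : (2 * (m / n)) ^ 2 = 2 * (n + 1) / n ^ 2 * (2 * m ^ 2 / (n + 1)) := by
    field_simp
  rw [h1, h2] at h
  have h3 := lt_of_mul_lt_mul_left h (by positivity)
  rw [Real.log_lt_iff_lt_exp (by positivity)] at h3
  rw [gaussMix, le_div_iff₀ hs]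
  linarith

/-! ### Ville's inequality -/

section Ville

variable {Ω : Type*} [mΩ : MeasurableSpace Ω] {P : Measure Ω} [IsProbabilityMeasure P]
  {ℱ : Filtration ℕ mΩ} {Z : ℕ → Ω → ℝ}

/-- Ville's inequality. -/
theorem measure_exists_ge_le_of_supermartingale (hmeas : ∀ t, Measurable[ℱ t] (Z t))
    (hnonneg : ∀ t ω, 0 ≤ Z t ω) (hint : ∀ t, Integrable (Z t) P)
    (hstep : ∀ t F, MeasurableSet[ℱ t] F → ∫ ω in F, Z (t + 1) ω ∂P ≤ ∫ ω in F, Z t ω ∂P)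
    {c : ℝ} (hc : 0 < c) :
    P {ω | ∃ t, c ≤ Z t ω} ≤ ENNReal.ofReal ((∫ ω, Z 0 ω ∂P) / c) := by
  set E : ℕ → Set Ω := fun n => {ω | ∃ t ≤ n, c ≤ Z t ω} with hE
  have hEmeas : ∀ n, MeasurableSet[ℱ n] (E n) := by
    intro n
    have : E n = ⋃ t ∈ Set.Iic n, {ω | c ≤ Z t ω} := by
      ext ω
      simp [hE]
    rw [this]
    exact MeasurableSet.biUnion (Set.to_countable _) fun t ht =>
      ℱ.mono ht _ (measurableSet_le measurable_const (hmeas t))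
  have hge : ∀ n, MeasurableSet {ω | c ≤ Z n ω} := fun n =>
    ℱ.le n _ (measurableSet_le measurable_const (hmeas n))
  have hmarkov : ∀ n G, MeasurableSet G → G ⊆ {ω | c ≤ Z n ω} →
      c * P.real G ≤ ∫ ω in G, Z n ω ∂P := by
    intro n G hG hsub
    have := setIntegral_mono_on (μ := P) (integrableOn_const (s := G) (C := c))
      (hint n).integrableOn hG fun ω hω => hsub hω
    rwa [setIntegral_const, smul_eq_mul, mul_comm] at this
  -- Optional stopping in disguise: paths that have crossed `c` are charged `c`, the others still
  -- carry `Z n`.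
  have hmain : ∀ n, c * P.real (E n) + ∫ ω in (E n)ᶜ, Z n ω ∂P ≤ ∫ ω, Z 0 ω ∂P := by
    intro n
    induction n with
    | zero =>
      have hm : MeasurableSet (E 0) := ℱ.le 0 _ (hEmeas 0)
      rw [← integral_add_compl hm (hint 0)]
      gcongr
      exact hmarkov 0 _ hm fun ω ⟨t, ht, h⟩ => by
        obtain rfl : t = 0 := by omega
        exact h
    | succ n ih =>
      have hm : MeasurableSet (E n) := ℱ.le n _ (hEmeas n)
      have hsucc : E (n + 1) = E n ∪ ((E n)ᶜ ∩ {ω | c ≤ Z (n + 1) ω}) := by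
        ext ω
        simp only [hE, Set.mem_union, Set.mem_inter_iff, Set.mem_compl_iff, Set.mem_ofPred_eq]
        constructor
        · rintro ⟨t, ht, h⟩
          by_cases hn : ∃ t ≤ n, c ≤ Z t ω
          · exact Or.inl hn
          · refine Or.inr ⟨hn, ?_⟩
            rcases Nat.le_succ_iff.1 ht with h' | rfl
            exacts [absurd ⟨t, h', h⟩ hn, h]
        · rintro (⟨t, ht, h⟩ | ⟨-, h⟩)
          exacts [⟨t, by omega, h⟩, ⟨n + 1, le_rfl, h⟩]
      have hcompl : (E (n + 1))ᶜ = (E n)ᶜ \ {ω | c ≤ Z (n + 1) ω} := by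
        rw [hsucc]
        ext ω
        simp only [Set.mem_compl_iff, Set.mem_union, Set.mem_inter_iff, Set.mem_sdiff]
        tauto
      have h1 := hmarkov (n + 1) _ (hm.compl.inter (hge (n + 1))) Set.inter_subset_right
      have h2 : P.real (E (n + 1)) = P.real (E n) + P.real ((E n)ᶜ ∩ {ω | c ≤ Z (n + 1) ω}) := by
        rw [hsucc, measureReal_union (disjoint_compl_right.mono_right Set.inter_subset_left)
          (hm.compl.inter (hge (n + 1)))]
      have h3 := integral_inter_add_sdiff (μ := P) (s := (E n)ᶜ) (hge (n + 1))
        (hint (n + 1)).integrableOn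
      have h4 := hstep n _ (hEmeas n).compl
      rw [h2, hcompl]
      linarith
  have hfin : ∀ n, P (E n) ≤ ENNReal.ofReal ((∫ ω, Z 0 ω ∂P) / c) := by
    intro n
    rw [← ofReal_measureReal]
    refine ENNReal.ofReal_le_ofReal ((le_div_iff₀ hc).2 ?_)
    have := setIntegral_nonneg (μ := P) (ℱ.le n _ (hEmeas n).compl) fun ω _ => hnonneg n ω
    linarith [hmain n]
  have hunion : {ω | ∃ t, c ≤ Z t ω} = ⋃ n, E n := by
    ext ω
    simp only [hE, Set.mem_ofPred_eq, Set.mem_iUnion]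
    exact ⟨fun ⟨t, h⟩ => ⟨t, t, le_rfl, h⟩, fun ⟨_, t, _, h⟩ => ⟨t, h⟩⟩
  have hmono : Monotone E := fun m n hmn ω ⟨t, ht, h⟩ => ⟨t, ht.trans hmn, h⟩
  rw [hunion, hmono.measure_iUnion]
  exact iSup_le hfin

end Ville

/-! ### Counts along a trajectory and their mixture supermartingale -/

section Trajectory

variable {S A Ω : Type*} [DecidableEq S] [DecidableEq A]

/-- How often, during the first `t` steps, the pair `ℓ` was played and led into `B`. -/
def hits (s : ℕ → Ω → S) (a : ℕ → Ω → A) (B : Finset S) (t : ℕ) (ω : Ω) (ℓ : S × A) : ℕ :=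
  ((Finset.range t).filter fun τ => (s τ ω, a τ ω) = ℓ ∧ s (τ + 1) ω ∈ B).card

variable {s : ℕ → Ω → S} {a : ℕ → Ω → A} {ℓ : S × A} {B : Finset S} {t : ℕ} {ω : Ω}

theorem visits_succ : visits s a (t + 1) ω ℓ =
    visits s a t ω ℓ + if (s t ω, a t ω) = ℓ then 1 else 0 := by
  simp only [visits, Finset.card_filter, Finset.sum_range_succ]

theorem hits_succ : hits s a B (t + 1) ω ℓ =
    hits s a B t ω ℓ + if (s t ω, a t ω) = ℓ ∧ s (t + 1) ω ∈ B then 1 else 0 := by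
  simp only [hits, Finset.card_filter, Finset.sum_range_succ]

theorem hits_le_visits : hits s a B t ω ℓ ≤ visits s a t ω ℓ :=
  Finset.card_le_card (Finset.monotone_filter_right _ fun _ _ h => h.1)

theorem visits_le : visits s a t ω ℓ ≤ t :=
  (Finset.card_filter_le _ _).trans (Finset.card_range t).le

theorem sum_visits [Fintype S] [Fintype A] : ∑ ℓ, visits s a t ω ℓ = t := by
  have := Finset.card_eq_sum_card_fiberwise (s := Finset.range t) (t := Finset.univ)
    (f := fun τ => (s τ ω, a τ ω)) fun _ _ => Finset.mem_coe.2 (Finset.mem_univ _)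
  rw [Finset.card_range] at this
  exact this.symm

theorem sum_empirical : ∑ x ∈ B, empirical s a t ω ℓ x =
    (hits s a B t ω ℓ : ℝ) / (visits s a t ω ℓ : ℝ) := by
  simp only [empirical, ← Finset.sum_div]
  congr 1
  norm_cast
  have := Finset.card_eq_sum_card_fiberwise
    (s := (Finset.range t).filter fun τ => (s τ ω, a τ ω) = ℓ ∧ s (τ + 1) ω ∈ B) (t := B)
    (f := fun τ => s (τ + 1) ω) fun τ hτ => (Finset.mem_filter.1 hτ).2.2
  rw [hits, this]
  refine Finset.sum_congr rfl fun x hx => ?_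
  rw [Finset.filter_filter]
  congr 1
  refine Finset.filter_congr fun τ _ => ?_
  constructor
  · rintro ⟨h, rfl⟩
    exact ⟨⟨h, hx⟩, rfl⟩
  · rintro ⟨⟨h, -⟩, rfl⟩
    exact ⟨h, rfl⟩

theorem hits_univ [Fintype S] : hits s a Finset.univ t ω ℓ = visits s a t ω ℓ := by
  simp [hits, visits]

/-- The mixture supermartingale of the transitions from `ℓ` into `B`, where `q` is the probability
of such a transition. -/
def transitionMix (s : ℕ → Ω → S) (a : ℕ → Ω → A) (B : Finset S) (q : ℝ) (ℓ : S × A) (t : ℕ)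
    (ω : Ω) : ℝ :=
  gaussMix (visits s a t ω ℓ) (hits s a B t ω ℓ - q * visits s a t ω ℓ)

theorem abs_hits_sub_le {q : ℝ} (hq : q ∈ Set.Icc (0 : ℝ) 1) :
    |(hits s a B t ω ℓ : ℝ) - q * visits s a t ω ℓ| ≤ t := by
  have h1 : (hits s a B t ω ℓ : ℝ) ≤ visits s a t ω ℓ := by
    exact_mod_cast hits_le_visits (s := s) (a := a) (ℓ := ℓ) (B := B) (t := t) (ω := ω)
  have h2 : (visits s a t ω ℓ : ℝ) ≤ t := by
    exact_mod_cast visits_le (s := s) (a := a) (ℓ := ℓ) (t := t) (ω := ω)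
  have h3 : (0 : ℝ) ≤ hits s a B t ω ℓ := Nat.cast_nonneg _
  have h4 : (0 : ℝ) ≤ visits s a t ω ℓ := Nat.cast_nonneg _
  have h5 := mul_le_of_le_one_left h4 hq.2
  have h6 := mul_nonneg hq.1 h4
  exact abs_le.2 ⟨by linarith, by linarith⟩

end Trajectory

namespace MDP.IsInteraction

variable {S A Ω : Type*} [Fintype S] [DecidableEq S] [Fintype A] [DecidableEq A]
  [mΩ : MeasurableSpace Ω] {P : Measure Ω} [IsProbabilityMeasure P] {M : MDP S A}
  {ℱ : Filtration ℕ mΩ} {s : ℕ → Ω → S} {a : ℕ → Ω → A} {r : ℕ → Ω → ℝ}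

theorem measurableSet_pair (h : M.IsInteraction P ℱ s a r) (t : ℕ) (ℓ : S × A) :
    MeasurableSet[ℱ t] {ω | (s t ω, a t ω) = ℓ} := by
  convert (h.state_meas t ℓ.1).inter (h.action_meas t ℓ.2) using 1
  ext ω
  simp [Prod.ext_iff]

theorem measurableSet_state_mem (h : M.IsInteraction P ℱ s a r) (t : ℕ) (B : Finset S) :
    MeasurableSet[ℱ t] {ω | s t ω ∈ B} := by
  have : {ω | s t ω ∈ B} = ⋃ x ∈ B, {ω | s t ω = x} := by
    ext ω
    simp
  rw [this]
  exact Finset.measurableSet_biUnion B fun x _ => h.state_meas t x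

theorem measurable_visits (h : M.IsInteraction P ℱ s a r) (t : ℕ) (ℓ : S × A) :
    Measurable[ℱ t] fun ω => (visits s a t ω ℓ : ℝ) := by
  simp only [visits, Finset.card_filter, Nat.cast_sum, Nat.cast_ite, Nat.cast_one, Nat.cast_zero]
  refine Finset.measurable_sum _ fun τ hτ => ?_
  exact Measurable.ite (ℱ.mono (Finset.mem_range.1 hτ).le _ (h.measurableSet_pair τ ℓ))
    measurable_const measurable_const

theorem measurable_hits (h : M.IsInteraction P ℱ s a r) (B : Finset S) (t : ℕ) (ℓ : S × A) :
    Measurable[ℱ t] fun ω => (hits s a B t ω ℓ : ℝ) := by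
  simp only [hits, Finset.card_filter, Nat.cast_sum, Nat.cast_ite, Nat.cast_one, Nat.cast_zero]
  refine Finset.measurable_sum _ fun τ hτ => ?_
  have hτ' := Finset.mem_range.1 hτ
  exact Measurable.ite ((ℱ.mono hτ'.le _ (h.measurableSet_pair τ ℓ)).inter
    (ℱ.mono hτ' _ (h.measurableSet_state_mem (τ + 1) B))) measurable_const measurable_const

theorem measurable_gaussMix_comp {m : MeasurableSpace Ω} {f g : Ω → ℝ} (hf : Measurable f)
    (hg : Measurable g) : Measurable fun ω => gaussMix (f ω) (g ω) := by
  unfold gaussMix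
  fun_prop

theorem condExp_state (h : M.IsInteraction P ℱ s a r) (t : ℕ) (B : Finset S) :
    P[{ω | s (t + 1) ω ∈ B}.indicator (fun _ => (1 : ℝ)) | ℱ t] =ᵐ[P]
      fun ω => ∑ x ∈ B, M.p (s t ω) (a t ω) x := by
  have hsum : {ω | s (t + 1) ω ∈ B}.indicator (fun _ => (1 : ℝ)) =
      ∑ x ∈ B, {ω | s (t + 1) ω = x}.indicator (fun _ => (1 : ℝ)) := by
    funext ω
    simp [Set.indicator_apply]
  have hx : ∀ x, P[{ω | s (t + 1) ω = x}.indicator (fun _ => (1 : ℝ)) | ℱ t] =ᵐ[P]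
      fun ω => M.p (s t ω) (a t ω) x := by
    intro x
    have hp : ∀ ω, (M.ν (s t ω) (a t ω)).real Set.univ = 1 := fun ω => by
      have := M.ν_prob (s t ω) (a t ω)
      exact probReal_univ
    -- Taking the whole line as reward set integrates the reward out.
    simpa [hp] using h.law t Set.univ MeasurableSet.univ x
  rw [hsum]
  refine (condExp_finsetSum (fun x _ => (integrable_const (1 : ℝ)).indicator
    (ℱ.le _ _ (h.state_meas (t + 1) x))) _).trans ?_
  have hall : ∀ᵐ ω ∂P, ∀ x, (P[{ω | s (t + 1) ω = x}.indicator (fun _ => (1 : ℝ)) | ℱ t]) ω =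
      M.p (s t ω) (a t ω) x := ae_all_iff.2 hx
  filter_upwards [hall] with ω hω
  simp [hω]

/-- On the event that `ℓ` is played at time `t`, the next state is in `B` with probability
`∑ x ∈ B, p(x | ℓ)`, independently of the past. -/
theorem setIntegral_mul_indicator (h : M.IsInteraction P ℱ s a r) (t : ℕ) (B : Finset S)
    (ℓ : S × A) {G : Set Ω} (hG : MeasurableSet[ℱ t] G) (hGℓ : ∀ ω ∈ G, (s t ω, a t ω) = ℓ)
    {V : Ω → ℝ} (hV : Measurable[ℱ t] V) {c : ℝ} (hc : ∀ ω, |V ω| ≤ c) :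
    ∫ ω in G, V ω * {ω | s (t + 1) ω ∈ B}.indicator (fun _ => (1 : ℝ)) ω ∂P =
      ∫ ω in G, V ω * ∑ x ∈ B, M.p ℓ.1 ℓ.2 x ∂P := by
  have hE : MeasurableSet {ω | s (t + 1) ω ∈ B} := ℱ.le _ _ (h.measurableSet_state_mem (t + 1) B)
  have hI : Integrable ({ω | s (t + 1) ω ∈ B}.indicator (fun _ => (1 : ℝ))) P :=
    (integrable_const (1 : ℝ)).indicator hE
  have hVI : Integrable (V * {ω | s (t + 1) ω ∈ B}.indicator (fun _ => (1 : ℝ))) P :=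
    hI.bdd_mul (hV.mono (ℱ.le t) le_rfl).aestronglyMeasurable
      (Filter.Eventually.of_forall hc)
  -- The factor `V`, known at time `t`, is pulled out of the conditional expectation.
  have hcond := condExp_stronglyMeasurable_mul_of_bound (μ := P) (ℱ.le t) hV.stronglyMeasurable hI c
    (Filter.Eventually.of_forall hc)
  refine (setIntegral_condExp (ℱ.le t) hVI hG).symm.trans ?_
  refine setIntegral_congr_ae (ℱ.le t _ hG) ?_
  filter_upwards [hcond, h.condExp_state t B] with ω h1 h2 hω
  rw [h1, Pi.mul_apply, h2]
  have := hGℓ ω hω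
  rw [← this]

/-- The process starts at `1` and moves only when `ℓ` is played, so it is a supermartingale in
global time and Ville's inequality applies without passing to the visit times of `ℓ`. -/
theorem measure_exists_le_transitionMix (h : M.IsInteraction P ℱ s a r) (B : Finset S) (ℓ : S × A)
    {c : ℝ} (hc : 0 < c) :
    P {ω | ∃ t, c ≤ transitionMix s a B (∑ x ∈ B, M.p ℓ.1 ℓ.2 x) ℓ t ω} ≤ ENNReal.ofReal (1 / c) := by
  set q := ∑ x ∈ B, M.p ℓ.1 ℓ.2 x with hqdef
  have hq : q ∈ Set.Icc (0 : ℝ) 1 := by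
    refine ⟨Finset.sum_nonneg fun x _ => (M.p_mem ℓ.1 ℓ.2).1 x, ?_⟩
    rw [← (M.p_mem ℓ.1 ℓ.2).2]
    exact Finset.sum_le_sum_of_subset_of_nonneg (Finset.subset_univ _) fun x _ _ =>
      (M.p_mem ℓ.1 ℓ.2).1 x
  have hmeas : ∀ t, Measurable[ℱ t] (transitionMix s a B q ℓ t) := fun t =>
    measurable_gaussMix_comp (h.measurable_visits t ℓ)
      ((h.measurable_hits B t ℓ).sub ((h.measurable_visits t ℓ).const_mul q))
  have hint : ∀ t, Integrable (transitionMix s a B q ℓ t) P := fun t =>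
    Integrable.of_bound ((hmeas t).mono (ℱ.le t) le_rfl).aestronglyMeasurable
      (Real.exp (2 * (t : ℝ) ^ 2)) (Filter.Eventually.of_forall fun ω => by
        rw [transitionMix, Real.norm_of_nonneg (gaussMix_nonneg _ _)]
        exact gaussMix_le (Nat.cast_nonneg _) (abs_hits_sub_le hq))
  have h0 : ∫ ω, transitionMix s a B q ℓ 0 ω ∂P = 1 := by
    simp [transitionMix, visits, hits, gaussMix]
  rw [← h0]
  refine measure_exists_ge_le_of_supermartingale hmeas (fun t ω => gaussMix_nonneg _ _) hint
    (fun t F hF => ?_) hc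
  have hL := h.measurableSet_pair t ℓ
  set L : Set Ω := {ω | (s t ω, a t ω) = ℓ} with hLdef
  have hL' : MeasurableSet L := ℱ.le t _ hL
  rw [← integral_inter_add_sdiff hL' (hint (t + 1)).integrableOn,
    ← integral_inter_add_sdiff hL' (hint t).integrableOn]
  have hout : ∫ ω in F \ L, transitionMix s a B q ℓ (t + 1) ω ∂P =
      ∫ ω in F \ L, transitionMix s a B q ℓ t ω ∂P := by
    refine setIntegral_congr_fun ((ℱ.le t _ hF).diff hL') fun ω hω => ?_
    have hω' : ¬ (s t ω, a t ω) = ℓ := hω.2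
    simp [transitionMix, visits_succ, hits_succ, hω']
  rw [hout]
  gcongr 1
  have hFL : MeasurableSet[ℱ t] (F ∩ L) := hF.inter hL
  let N : Ω → ℝ := fun ω => visits s a t ω ℓ
  let m : Ω → ℝ := fun ω => hits s a B t ω ℓ - q * visits s a t ω ℓ
  have hNm : Measurable[ℱ t] N := h.measurable_visits t ℓ
  have hmm : Measurable[ℱ t] m :=
    (h.measurable_hits B t ℓ).sub ((h.measurable_visits t ℓ).const_mul q)
  -- On `L` the next value is `U 1` after a transition into `B` and `U 0` otherwise. It is affine in
  -- the indicator of `B`, which conditioning replaces by `q`.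
  let U : ℝ → Ω → ℝ := fun y ω => gaussMix (N ω + 1) (m ω + (y - q))
  have hU : ∀ y, Measurable[ℱ t] (U y) := fun y =>
    measurable_gaussMix_comp (hNm.add_const 1) (hmm.add_const (y - q))
  have hUb : ∀ y ∈ Set.Icc (0 : ℝ) 1, ∀ ω, |U y ω| ≤ Real.exp (2 * ((t : ℝ) + 1) ^ 2) := by
    intro y hy ω
    rw [abs_of_nonneg (gaussMix_nonneg _ _)]
    refine gaussMix_le (add_nonneg (Nat.cast_nonneg _) zero_le_one) ((abs_add_le _ _).trans ?_)
    refine add_le_add (abs_hits_sub_le hq) (abs_le.2 ⟨?_, ?_⟩) <;> linarith [hy.1, hy.2, hq.1, hq.2]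
  have h0m : (0 : ℝ) ∈ Set.Icc (0 : ℝ) 1 := by simp
  have h1m : (1 : ℝ) ∈ Set.Icc (0 : ℝ) 1 := by simp
  have hUint : ∀ y ∈ Set.Icc (0 : ℝ) 1, Integrable (U y) P := fun y hy =>
    Integrable.of_bound ((hU y).mono (ℱ.le t) le_rfl).aestronglyMeasurable _
      (Filter.Eventually.of_forall (hUb y hy))
  set I : Ω → ℝ := {ω | s (t + 1) ω ∈ B}.indicator (fun _ => (1 : ℝ)) with hI
  have hIint : Integrable I P := (integrable_const (1 : ℝ)).indicator
    (ℱ.le _ _ (h.measurableSet_state_mem (t + 1) B))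
  have hVm : Measurable[ℱ t] fun ω => U 1 ω - U 0 ω := (hU 1).sub (hU 0)
  have hVb : ∀ ω, |U 1 ω - U 0 ω| ≤
      Real.exp (2 * ((t : ℝ) + 1) ^ 2) + Real.exp (2 * ((t : ℝ) + 1) ^ 2) := fun ω =>
    (abs_sub _ _).trans (add_le_add (hUb 1 h1m ω) (hUb 0 h0m ω))
  have hVI : Integrable (fun ω => (U 1 ω - U 0 ω) * I ω) P :=
    hIint.bdd_mul (hVm.mono (ℱ.le t) le_rfl).aestronglyMeasurable (Filter.Eventually.of_forall hVb)
  have hVq : Integrable (fun ω => (U 1 ω - U 0 ω) * ∑ x ∈ B, M.p ℓ.1 ℓ.2 x) P :=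
    ((hUint 1 h1m).sub (hUint 0 h0m)).mul_const _
  have hsucc : ∫ ω in F ∩ L, transitionMix s a B q ℓ (t + 1) ω ∂P =
      ∫ ω in F ∩ L, (U 0 ω + (U 1 ω - U 0 ω) * I ω) ∂P := by
    refine setIntegral_congr_fun (ℱ.le t _ hFL) fun ω hω => ?_
    have hω' : (s t ω, a t ω) = ℓ := hω.2
    by_cases hB : s (t + 1) ω ∈ B
    · have hI1 : I ω = 1 := by simp [hI, hB]
      simp only [transitionMix, visits_succ, hits_succ, hω', hB, hI1, U, N, m]
      simp only [and_self, if_true, Nat.cast_add, Nat.cast_one]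
      ring_nf
    · have hI1 : I ω = 0 := by simp [hI, hB]
      simp only [transitionMix, visits_succ, hits_succ, hω', hB, hI1, U, N, m]
      simp only [and_false, if_true, if_false, Nat.cast_add, Nat.cast_one, add_zero]
      ring_nf
  rw [hsucc, integral_add (hUint 0 h0m).integrableOn hVI.integrableOn,
    h.setIntegral_mul_indicator t B ℓ hFL (fun ω hω => hω.2) hVm hVb,
    ← integral_add (hUint 0 h0m).integrableOn hVq.integrableOn]
  refine setIntegral_mono ((hUint 0 h0m).add hVq).integrableOn
    (hint t).integrableOn fun ω => ?_
  have := gaussMix_step (n := N ω) (Nat.cast_nonneg _) hq (m ω)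
  refine le_trans (le_of_eq ?_) this
  simp only [U, ← hqdef]
  ring

end MDP.IsInteraction

/-! ### Reduction to sets of next states and the union bound -/

/-- With equal sums, positive and negative parts balance: add `∑ (x - y) = 0` to the distance and
use `|z| + z = 2 max z 0`. -/
theorem l1dist_eq_two_mul {ι : Type*} [Fintype ι] [DecidableEq ι] {x y : ι → ℝ}
    (h : ∑ i, x i = ∑ i, y i) :
    l1dist x y = 2 * (∑ i with y i < x i, x i - ∑ i with y i < x i, y i) := by
  have h1 : ∑ i, (|x i - y i| + (x i - y i)) = l1dist x y := by
    rw [Finset.sum_add_distrib, Finset.sum_sub_distrib, h, sub_self, add_zero, l1dist]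
  rw [← h1, ← Finset.sum_sub_distrib, Finset.mul_sum, Finset.sum_filter]
  refine Finset.sum_congr rfl fun i _ => ?_
  split_ifs with hi
  · rw [abs_of_pos (by linarith)]
    ring
  · rw [abs_of_nonpos (by linarith)]
    ring

/-- If an empirical transition distribution is further than the confidence width from the
transition probabilities, then the mixture process is large for some proper non-empty set of next
states. -/
theorem exists_le_transitionMix {S A Ω : Type*} [Fintype S] [DecidableEq S] [DecidableEq A]
    (M : MDP S A) (s : ℕ → Ω → S) (a : ℕ → Ω → A) {t : ℕ} {ω : Ω} {ℓ : S × A} {η : ℝ} (hη : 0 < η)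
    (hN : 0 < visits s a t ω ℓ)
    (hlt : confWidth (Fintype.card S) (visits s a t ω ℓ) η <
      l1dist (empirical s a t ω ℓ) (M.p ℓ.1 ℓ.2)) :
    ∃ B : Finset S, B ≠ ∅ ∧ B ≠ Finset.univ ∧ ((2 : ℝ) ^ Fintype.card S - 2) / η ≤
      transitionMix s a B (∑ x ∈ B, M.p ℓ.1 ℓ.2 x) ℓ t ω := by
  have hNpos : (0 : ℝ) < visits s a t ω ℓ := by exact_mod_cast hN
  have hsum : ∑ x, empirical s a t ω ℓ x = ∑ x, M.p ℓ.1 ℓ.2 x := by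
    rw [sum_empirical, hits_univ, div_self hNpos.ne', (M.p_mem ℓ.1 ℓ.2).2]
  have hl := l1dist_eq_two_mul hsum
  set B : Finset S := Finset.univ.filter fun x => M.p ℓ.1 ℓ.2 x < empirical s a t ω ℓ x with hB
  have hpos := (confWidth_nonneg (Fintype.card S) (visits s a t ω ℓ) η).trans_lt hlt
  -- If `B` were empty or everything, equal total masses would make the L¹ distance `0`.
  have hne : B ≠ ∅ := by
    intro h
    rw [h] at hl
    simp at hl
    linarith
  have hnu : B ≠ Finset.univ := by
    intro h
    rw [h, hsum] at hl
    simp at hl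
    linarith
  refine ⟨B, hne, hnu, ?_⟩
  have hcard : 1 < Fintype.card S := by
    have h1 := Finset.card_pos.2 (Finset.nonempty_iff_ne_empty.2 hne)
    have h2 := (Finset.card_lt_iff_ne_univ B).2 hnu
    omega
  have hc : 0 < ((2 : ℝ) ^ Fintype.card S - 2) / η := by
    have h4 : (2 : ℝ) ^ 2 ≤ 2 ^ Fintype.card S := pow_le_pow_right₀ (by norm_num) hcard
    exact div_pos (by linarith) hη
  refine le_gaussMix_of_sqrt_lt hNpos hc ?_
  rw [hl, sum_empirical] at hlt
  refine hlt.trans_eq ?_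
  field_simp

theorem card_proper_nonempty (S : Type*) [Fintype S] [DecidableEq S] [Nonempty S] :
    ((Finset.univ.filter fun B : Finset S => B ≠ ∅ ∧ B ≠ Finset.univ).card : ℝ) =
      2 ^ Fintype.card S - 2 := by
  have h : (Finset.univ.filter fun B : Finset S => B ≠ ∅ ∧ B ≠ Finset.univ) =
      Finset.univ \ {∅, Finset.univ} := by
    ext B
    simp
  have h2 : ({∅, Finset.univ} : Finset (Finset S)).card = 2 :=
    Finset.card_pair Finset.univ_nonempty.ne_empty.symm
  have h3 := Finset.card_le_univ ({∅, Finset.univ} : Finset (Finset S))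
  rw [h, Finset.card_sdiff_of_subset (Finset.subset_univ _), h2, Finset.card_univ,
    Fintype.card_finset, Nat.cast_sub (by rwa [h2, Fintype.card_finset] at h3)]
  simp

/-- The probability that some empirical transition distribution ever leaves its confidence width is
at most `δ`. -/
theorem MDP.IsInteraction.measure_exists_confWidth_lt_le {S A Ω : Type*} [Fintype S]
    [DecidableEq S] [Fintype A] [DecidableEq A] [mΩ : MeasurableSpace Ω] {P : Measure Ω}
    [IsProbabilityMeasure P] {M : MDP S A} {ℱ : Filtration ℕ mΩ} {s : ℕ → Ω → S} {a : ℕ → Ω → A}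
    {r : ℕ → Ω → ℝ} (h : M.IsInteraction P ℱ s a r) {δ : ℝ} (hδ0 : 0 < δ) :
    P {ω | ∃ (t : ℕ) (ℓ : S × A), 0 < visits s a t ω ℓ ∧
      confWidth (Fintype.card S) (visits s a t ω ℓ)
        (δ / ((Fintype.card S : ℝ) * (Fintype.card A : ℝ))) <
      l1dist (empirical s a t ω ℓ) (M.p ℓ.1 ℓ.2)} ≤ ENNReal.ofReal δ := by
  obtain ⟨ω₀⟩ : Nonempty Ω := P.nonempty_of_neZero
  have : Nonempty S := ⟨s 0 ω₀⟩
  have : Nonempty A := ⟨a 0 ω₀⟩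
  have hS : (0 : ℝ) < Fintype.card S := by exact_mod_cast Fintype.card_pos
  have hA : (0 : ℝ) < Fintype.card A := by exact_mod_cast Fintype.card_pos
  set η := δ / ((Fintype.card S : ℝ) * (Fintype.card A : ℝ)) with hη
  have hη0 : 0 < η := by positivity
  set 𝓑 := Finset.univ.filter fun B : Finset S => B ≠ ∅ ∧ B ≠ Finset.univ with h𝓑
  have hcard := card_proper_nonempty S
  rw [← h𝓑] at hcard
  set c := ((2 : ℝ) ^ Fintype.card S - 2) / η with hc
  calc _ ≤ P (⋃ z ∈ (Finset.univ : Finset (S × A)) ×ˢ 𝓑,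
        {ω | ∃ t, c ≤ transitionMix s a z.2 (∑ x ∈ z.2, M.p z.1.1 z.1.2 x) z.1 t ω}) := by
        refine measure_mono ?_
        rintro ω ⟨t, ℓ, hN, hlt⟩
        obtain ⟨B, h1, h2, h3⟩ := exists_le_transitionMix M s a hη0 hN hlt
        simp only [Set.mem_iUnion]
        exact ⟨(ℓ, B), by simp [h𝓑, h1, h2], t, h3⟩
    _ ≤ ∑ z ∈ (Finset.univ : Finset (S × A)) ×ˢ 𝓑, ENNReal.ofReal (1 / c) := by
        refine (measure_biUnion_finset_le _ _).trans (Finset.sum_le_sum fun z hz => ?_)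
        have hpos : 0 < (𝓑.card : ℝ) := by
          exact_mod_cast Finset.card_pos.2 ⟨z.2, (Finset.mem_product.1 hz).2⟩
        exact h.measure_exists_le_transitionMix z.2 z.1 (div_pos (hcard ▸ hpos) hη0)
    _ ≤ ENNReal.ofReal δ := by
        rw [Finset.sum_const, Finset.card_product, Finset.card_univ, Fintype.card_prod,
          nsmul_eq_mul, ← ENNReal.ofReal_natCast, ← ENNReal.ofReal_mul (Nat.cast_nonneg _)]
        refine ENNReal.ofReal_le_ofReal ?_
        rw [Nat.cast_mul, hcard, Nat.cast_mul, hc]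
        -- For a single state there are no sets `B` and the sum is empty; otherwise the `S A (2 ^ S
        -- - 2)` terms `1 / c` add up to exactly `δ`.
        by_cases h0 : (2 : ℝ) ^ Fintype.card S - 2 = 0
        · simp [h0, hδ0.le]
        · refine le_of_eq ?_
          rw [hη]
          field_simp

/-! ### The proposition -/

theorem proposition1 {S A Ω : Type*} [Fintype S] [DecidableEq S] [Fintype A] [DecidableEq A]
    [mΩ : MeasurableSpace Ω] (P : Measure Ω) [IsProbabilityMeasure P] (M : MDP S A)
    (ℱ : Filtration ℕ mΩ) (s : ℕ → Ω → S) (a : ℕ → Ω → A) (r : ℕ → Ω → ℝ)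
    (hproc : M.IsInteraction P ℱ s a r)
    (δ : ℝ) (hδ0 : 0 < δ) (hδ1 : δ ≤ 1)
    (Δ : ℝ) (hΔ : 0 < Δ) (hsep : M.Separated Δ) :
    ENNReal.ofReal (1 - δ) ≤ P {ω | ∀ t : ℕ,
      (∀ ℓ, sepFunInv (Fintype.card S) (Fintype.card A) δ Δ < (visits s a t ω ℓ : ℝ)) →
      ∀ α : ℝ, 1 < α →
        (t : ℝ) / max 1 (sepFunInv (Fintype.card S) (Fintype.card A) δ Δ) ≤ α →
      ∀ 𝒟 : Finset (Finset (S × A)),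
        ClusterInput.Outputs ⟨α, δ, visits s a t ω, empirical s a t ω⟩ 𝒟 ↔ 𝒟 = M.classes} := by
  set bad : Set Ω := {ω | ∃ (t : ℕ) (ℓ : S × A), 0 < visits s a t ω ℓ ∧
      confWidth (Fintype.card S) (visits s a t ω ℓ)
        (δ / ((Fintype.card S : ℝ) * (Fintype.card A : ℝ))) <
      l1dist (empirical s a t ω ℓ) (M.p ℓ.1 ℓ.2)} with hbad
  have hP : P bad ≤ ENNReal.ofReal δ := hproc.measure_exists_confWidth_lt_le hδ0
  have hcompl : ENNReal.ofReal (1 - δ) ≤ P badᶜ := by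
    rw [ENNReal.ofReal_sub _ hδ0.le, ENNReal.ofReal_one]
    refine tsub_le_iff_right.2 ?_
    -- Subadditivity suffices here, so measurability of `bad` is not needed.
    calc (1 : ENNReal) = P (badᶜ ∪ bad) := by rw [Set.compl_union_self, measure_univ]
      _ ≤ P badᶜ + P bad := measure_union_le _ _
      _ ≤ P badᶜ + ENNReal.ofReal δ := by gcongr
  refine hcompl.trans (measure_mono ?_)
  intro ω hω
  rw [Set.mem_ofPred_eq]
  intro t hN α _ hα 𝒟
  have hsum : ∑ ℓ, (visits s a t ω ℓ : ℝ) = t := by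
    exact_mod_cast sum_visits (s := s) (a := a) (t := t) (ω := ω)
  have hwidth : ∀ ℓ, l1dist (empirical s a t ω ℓ) (M.p ℓ.1 ℓ.2) ≤
      confWidth (Fintype.card S) (visits s a t ω ℓ)
        (δ / ((Fintype.card S : ℝ) * (Fintype.card A : ℝ))) := by
    intro ℓ
    by_contra! hlt
    have hpos : 0 < visits s a t ω ℓ := by
      exact_mod_cast (sepFunInv_nonneg _ _ _ _).trans_lt (hN ℓ)
    exact hω ⟨t, ℓ, hpos, hlt⟩
  have hα' : (∑ ℓ, (visits s a t ω ℓ : ℝ)) /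
      max 1 (sepFunInv (Fintype.card S) (Fintype.card A) δ Δ) ≤ α := by rwa [hsum]
  have hD : ClusterInput.Resolves ⟨α, δ, visits s a t ω, empirical s a t ω⟩ M.similarSetoid :=
    ClusterInput.resolves_of_l1dist_le _ M hΔ hsep hδ0 hδ1 hN hα' hwidth
  exact ClusterInput.outputs_iff hD M.mem_classes 𝒟

end
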